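/- \textbf{Setting.} Consider a finite-horizon constrained MDP with finite state space $\mathcal S$ ($|\mathcal S|=S$), finite action space $\mathcal A$ ($|\mathcal A|=A$), horizon $H$, initial distribution $p$, transition kernel $P(s'\mid s,a,h)$, $h\in[H]$ (with the convention $P(\cdot\mid s,a,H)=p$), and reward and cost functions $f,g:\mathcal S\times\mathcal A\times[H]\to[0,1]$. For a policy $\pi(a\mid s,h)$, a transition kernel $Q$ and $\ell:\mathcal S\times\mathcal A\times[H]\to\mathbb R$, let $V_1^\pi(\ell,Q)=\mathbb E\big[\sum_{h=1}^H\ell(s_h,a_h,h)\big]$, where $s_1\sim p$, $a_h\sim\pi(\cdot\mid s_h,h)$, $s_{h+1}\sim Q(\cdot\mid s_h,a_h,h)$. Let $\bar C\in(0,H)$ be the budget and $\pi_b$ a known baseline policy with known cost $\bar C_b=V_1^{\pi_b}(g,P)<\bar C$. Over $K$ episodes the agent plays policies $\pi_1,\dots,\pi_K$; in episode $k$ it observes the trajectory $s_1,a_1,\dots,s_H,a_H,s_{H+1}$ generated by $P,\pi_k$, and the values at the visited $(s_h,a_h,h)$ of $f_k=f+\zeta_k^f$ and $g_k=g+\zeta_k^g$,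 where the noise variables $\zeta_k^f(s,a,h),\zeta_k^g(s,a,h)$ are independent, have mean zero and satisfy $\mathbb E[e^{\lambda\zeta}]\le e^{\lambda^2/4}$ for all $\lambda\in\mathbb R$; the noise of episode $k$ is independent of the earlier episodes and of the trajectory of episode $k$. \textbf{Estimators.} Let $\delta\in(0,1)$ and $L=\ln(HSAK/\delta)$. Let $n_j(s,a,h)$ be the indicator that episode $j$ visits $(s,a)$ at step $h$, let $N_k(s,a,h)=\sum_{j<k}n_j(s,a,h)$, let $M_k(s,a,s',h)$ be the number of episodes $j<k$ that visit $(s,a)$ at step $h$ and then move to $s'$, and let $D_k=\max\{1,N_k-1\}$. Put $$\bar P_k(s'\mid s,a,h)=\frac{M_k(s,a,s',h)}{\max\{1,N_k(s,a,h)\}},\quad \bar f_k=\frac{\sum_{j<k}f_jn_j}{\max\{1,N_k\}},\quad \bar g_k=\frac{\sum_{j<k}g_jn_j}{\max\{1,N_k\}},\quad R_k=\sqrt{\frac{L}{\max\{1,N_k\}}},$$ $$\epsilon_k(s'\mid s,a,h)=2\sqrt{\frac{\bar P_k(s'\mid s,a,h)L}{D_k(s,a,h)}}+\frac{14L}{3D_k(s,a,h)},\qquad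 \varepsilon_k=2\sqrt{\frac{SL}{D_k}}+\frac{14SL}{3D_k},$$ $$U_k=8\sqrt H\,\varepsilon_k+4S\sqrt{HA/K}+\frac{2\sqrt{HK/A}\,L+\eta}{D_k},\qquad \eta=(19HS+2H^{1.5}S+10^4H^2S^2)L^2,$$ $$\widehat g_k=\bar g_k+R_k+U_k,\qquad \widehat f_k=\min\Big\{1+\sqrt L,\ \bar f_k+\tfrac{3H}{\bar C-\bar C_b}R_k+\tfrac{H}{\bar C-\bar C_b}U_k\Big\},$$ and let $\mathcal P_k$ be the set of transition kernels $Q$ with $|Q-\bar P_k|\le\epsilon_k$ at all $(s,a,s',h)$. \textbf{DOPE+} with $K_0$ initial episodes plays $\pi_k=\pi_b$ for $k\le K_0$, and for $k>K_0$ it takes $$(\pi_k,P_k)\in\operatorname{argmax}\big\{V_1^\pi(\widehat f_k,Q):\ \pi\text{ a policy},\ Q\in\mathcal P_k,\ V_1^\pi(\widehat g_k,Q)\le\bar C\big\}.\tag{LP}$$ We say that DOPE+ computes the policy of episode $k$ if $k\le K_0$ or (LP) is feasible in episode $k$; if (LP) is infeasible, DOPE+ computes no policy and an arbitrary (history-dependent)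 policy is played in that episode. \textbf{Theorem.} For every $K$ and every $K_0\ge0$, there is an event of probability at least $1-14\delta$ on which the following hold. (i) Every policy $\pi_k$, $k\in[K]$, computed by DOPE+ satisfies the true constraint $V_1^{\pi_k}(g,P)\le\bar C$. (ii) If all $K$ policies are computed by DOPE+, then $\mathrm{Violation}(\vec\pi):=\sum_{k=1}^K\max\{0,V_1^{\pi_k}(g,P)-\bar C\}=0$. (iii) DOPE+ computes the policy of every episode $k\in[K]$ such that $k\le K_0$ or $V_1^{\pi_b}(2R_k+U_k,P)\le\bar C-\bar C_b$. In particular, if $K_0$ is such that the latter inequality holds for all $K_0<k\le K$, then all $K$ policies are computed and $\mathrm{Violation}(\vec\pi)=0$. -/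

import Mathlib

open MeasureTheory ProbabilityTheory

noncomputable section

namespace DOPEPlus

/-! ### Policies, transition kernels, trajectories, value functions

Steps `1, …, H` are indexed by `Fin H`. -/

/-- `π s h a` is `π(a ∣ s, h)`. -/
abbrev Pol (S A : Type*) (H : ℕ) := S → Fin H → A → ℝ

/-- `Q s a h s'` is `Q(s' ∣ s, a, h)`. -/
abbrev Ker (S A : Type*) (H : ℕ) := S → A → Fin H → S → ℝ

/-- Functions `ℓ(s, a, h)`. -/
abbrev Fn (S A : Type*) (H : ℕ) := S → A → Fin H → ℝ

/-- States `s_1, …, s_{H+1}` and actions `a_1, …, a_H` of one episode. -/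
abbrev Traj (S A : Type*) (H : ℕ) := (Fin (H + 1) → S) × (Fin H → A)

/-- The set `Π` of valid policies. -/
def IsPolicy {S A : Type*} [Fintype A] {H : ℕ} (π : Pol S A H) : Prop :=
  ∀ s h, (∀ a, 0 ≤ π s h a) ∧ ∑ a, π s h a = 1

/-- Valid transition kernels. -/
def IsKernel {S A : Type*} [Fintype S] {H : ℕ} (Q : Ker S A H) : Prop :=
  ∀ s a h, (∀ s', 0 ≤ Q s a h s') ∧ ∑ s', Q s a h s' = 1

/-- Probability of a trajectory: `s_1 ∼ p`, `a_h ∼ π(· ∣ s_h, h)`, `s_{h+1} ∼ Q(· ∣ s_h, a_h, h)`. -/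
def trajProb {S A : Type*} {H : ℕ} (p : S → ℝ) (π : Pol S A H) (Q : Ker S A H)
    (τ : Traj S A H) : ℝ :=
  p (τ.1 0) * ∏ h : Fin H,
    (π (τ.1 h.castSucc) h (τ.2 h) * Q (τ.1 h.castSucc) (τ.2 h) h (τ.1 h.succ))

/-- `V_1^π(ℓ, Q)`: the expectation of `∑_h ℓ(s_h, a_h, h)` over the trajectory generated by
`p`, `π` and `Q`. -/
def value {S A : Type*} [Fintype S] [Fintype A] [DecidableEq S] [DecidableEq A] {H : ℕ}
    (p : S → ℝ) (π : Pol S A H) (ℓ : Fn S A H) (Q : Ker S A H) : ℝ :=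
  ∑ τ : Traj S A H, trajProb p π Q τ * ∑ h : Fin H, ℓ (τ.1 h.castSucc) (τ.2 h) h

/-- A finite-horizon constrained MDP.  As a convention the transition out of the last step is
governed by the initial distribution. -/
structure CMDP (S A : Type*) [Fintype S] [Fintype A] (H : ℕ) where
  init : S → ℝ
  init_nonneg : ∀ s, 0 ≤ init s
  init_sum : ∑ s, init s = 1
  trans : Ker S A H
  trans_isKernel : IsKernel trans
  trans_last : ∀ s a s' (h : Fin H), h.val + 1 = H → trans s a h s' = init s'
  reward : Fn S A H
  reward_mem : ∀ s a h, reward s a h ∈ Set.Icc (0 : ℝ) 1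
  cost : Fn S A H
  cost_mem : ∀ s a h, cost s a h ∈ Set.Icc (0 : ℝ) 1
  /-- The budget `C̄`. -/
  budget : ℝ

/-! ### Observed histories and the estimators -/

/-- The record of one episode: trajectory, observed rewards, observed costs at steps `1, …, H`. -/
abbrev Episode (S A : Type*) (H : ℕ) := Traj S A H × (Fin H → ℝ) × (Fin H → ℝ)

/-- The records of the first `k` episodes. -/
abbrev Hist (S A : Type*) (H k : ℕ) := Fin k → Episode S A H

section Estimators

variable {S A : Type*} [Fintype S] [Fintype A] [DecidableEq S] [DecidableEq A] {H k : ℕ}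

/-- `n_j(s, a, h)`: indicator of a visit to `(s, a)` at step `h`. -/
def visit (e : Episode S A H) (s : S) (a : A) (h : Fin H) : ℕ :=
  if e.1.1 h.castSucc = s ∧ e.1.2 h = a then 1 else 0

/-- `N(s, a, h)`: number of visits in the recorded episodes. -/
def countN (w : Hist S A H k) (s : S) (a : A) (h : Fin H) : ℕ :=
  ∑ j, visit (w j) s a h

/-- `M(s, a, s', h)`: number of visits to `(s, a)` at step `h` followed by `s'`. -/
def countM (w : Hist S A H k) (s : S) (a : A) (s' : S) (h : Fin H) : ℕ :=
  ∑ j, if (w j).1.1 h.succ = s' then visit (w j) s a h else 0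

/-- The empirical kernel `P̄`. -/
def empKer (w : Hist S A H k) : Ker S A H := fun s a h s' =>
  (countM w s a s' h : ℝ) / max 1 (countN w s a h : ℝ)

/-- The empirical reward `f̄`. -/
def empReward (w : Hist S A H k) : Fn S A H := fun s a h =>
  (∑ j, (w j).2.1 h * (visit (w j) s a h : ℝ)) / max 1 (countN w s a h : ℝ)

/-- The empirical cost `ḡ`. -/
def empCost (w : Hist S A H k) : Fn S A H := fun s a h =>
  (∑ j, (w j).2.2 h * (visit (w j) s a h : ℝ)) / max 1 (countN w s a h : ℝ)

/-- `ln(HSAK/δ)`. -/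
def logTerm (S A : Type*) [Fintype S] [Fintype A] (H K : ℕ) (δ : ℝ) : ℝ :=
  Real.log ((H : ℝ) * (Fintype.card S : ℝ) * (Fintype.card A : ℝ) * (K : ℝ) / δ)

/-- `max{1, N(s, a, h) - 1}`. -/
def den (w : Hist S A H k) (s : S) (a : A) (h : Fin H) : ℝ :=
  max 1 ((countN w s a h : ℝ) - 1)

/-- The confidence radius `ϵ(s' ∣ s, a, h)` for transitions. -/
def radiusKer (K : ℕ) (δ : ℝ) (w : Hist S A H k) : Ker S A H := fun s a h s' =>
  2 * Real.sqrt (empKer w s a h s' * logTerm S A H K δ / den w s a h)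
    + 14 * logTerm S A H K δ / (3 * den w s a h)

/-- The confidence set of transition kernels. -/
def confSet (K : ℕ) (δ : ℝ) (w : Hist S A H k) : Set (Ker S A H) :=
  {Q | IsKernel Q ∧ ∀ s a h s', |Q s a h s' - empKer w s a h s'| ≤ radiusKer K δ w s a h s'}

/-- The confidence radius `R(s, a, h)` for rewards and costs. -/
def radiusFn (K : ℕ) (δ : ℝ) (w : Hist S A H k) : Fn S A H := fun s a h =>
  Real.sqrt (logTerm S A H K δ / max 1 (countN w s a h : ℝ))

/-- The function `ε(s, a, h)`. -/
def varEps (K : ℕ) (δ : ℝ) (w : Hist S A H k) : Fn S A H := fun s a h =>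
  2 * Real.sqrt ((Fintype.card S : ℝ) * logTerm S A H K δ / den w s a h)
    + 14 * (Fintype.card S : ℝ) * logTerm S A H K δ / (3 * den w s a h)

/-- The constant `η`. -/
def eta (S A : Type*) [Fintype S] [Fintype A] (H K : ℕ) (δ : ℝ) : ℝ :=
  (19 * (H : ℝ) * (Fintype.card S : ℝ) + 2 * (H : ℝ) ^ (3 / 2 : ℝ) * (Fintype.card S : ℝ)
    + 10 ^ 4 * (H : ℝ) ^ 2 * (Fintype.card S : ℝ) ^ 2) * (logTerm S A H K δ) ^ 2

/-- The extra pessimism `U(s, a, h)`. -/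
def bonusU (K : ℕ) (δ : ℝ) (w : Hist S A H k) : Fn S A H := fun s a h =>
  8 * Real.sqrt (H : ℝ) * varEps K δ w s a h
    + 4 * (Fintype.card S : ℝ) * Real.sqrt ((H : ℝ) * (Fintype.card A : ℝ) / (K : ℝ))
    + (2 * Real.sqrt ((H : ℝ) * (K : ℝ) / (Fintype.card A : ℝ)) * logTerm S A H K δ
        + eta S A H K δ) / den w s a h

/-- The pessimistic cost estimator `ĝ`. -/
def pessCost (K : ℕ) (δ : ℝ) (w : Hist S A H k) : Fn S A H := fun s a h =>
  empCost w s a h + radiusFn K δ w s a h + bonusU K δ w s a h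

/-- The optimistic reward estimator `f̂`; `gap` is `C̄ - C̄_b`. -/
def optReward (K : ℕ) (δ gap : ℝ) (w : Hist S A H k) : Fn S A H := fun s a h =>
  min (1 + Real.sqrt (logTerm S A H K δ))
    (empReward w s a h + 3 * (H : ℝ) / gap * radiusFn K δ w s a h
      + (H : ℝ) / gap * bonusU K δ w s a h)

/-- The feasible set of the optimization problem solved after the recorded episodes. -/
def feasibleSet (p : S → ℝ) (C : ℝ) (K : ℕ) (δ : ℝ) (w : Hist S A H k) :
    Set (Pol S A H × Ker S A H) :=
  {x | IsPolicy x.1 ∧ x.2 ∈ confSet K δ w ∧ value p x.1 (pessCost K δ w) x.2 ≤ C}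

/-- The set of optimal solutions of that problem. -/
def solutionSet (p : S → ℝ) (C : ℝ) (K : ℕ) (δ gap : ℝ) (w : Hist S A H k) :
    Set (Pol S A H × Ker S A H) :=
  {x | x ∈ feasibleSet p C K δ w ∧ IsMaxOn
    (fun y : Pol S A H × Ker S A H => value p y.1 (optReward K δ gap w) y.2)
    (feasibleSet p C K δ w) x}

end Estimators

/-! ### Learners and the law of a run -/

/-- A learner computes, after `k` recorded episodes, the policy for the next episode (and an
estimated kernel) as a function of these records. -/
structure Learner (S A : Type*) [Fintype A] [MeasurableSpace S] [MeasurableSpace A] (H : ℕ) where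
  policy : (k : ℕ) → Hist S A H k → Pol S A H
  kernel : (k : ℕ) → Hist S A H k → Ker S A H
  policy_isPolicy : ∀ k w, IsPolicy (policy k w)
  policy_measurable : ∀ k, Measurable (policy k)

/-- The learner runs DOPE+ for `K` episodes with `K₀` initial episodes: the baseline policy in the
first `K₀` episodes, then an optimal solution of the optimization problem in every episode in
which that problem has a feasible point.  (DOPE+ does not say what to do if it has none; the
learner may then play anything, and the policy does not count as computed by DOPE+, see
`Computed`.)  The episode that follows `k` recorded ones has number `k + 1`. -/
def IsDOPEPlus {S A : Type*} [Fintype S] [Fintype A] [DecidableEq S] [DecidableEq A]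
    [MeasurableSpace S] [MeasurableSpace A] {H : ℕ} (M : CMDP S A H) (πb : Pol S A H)
    (K K₀ : ℕ) (δ : ℝ) (L : Learner S A H) : Prop :=
  ∀ k, k < K → ∀ w : Hist S A H k,
    (k < K₀ → L.policy k w = πb) ∧
    (K₀ ≤ k → (feasibleSet M.init M.budget K δ w).Nonempty →
      (L.policy k w, L.kernel k w) ∈ solutionSet M.init M.budget K δ
        (M.budget - value M.init πb M.cost M.trans) w)

/-- After the records `w` of `k` episodes, DOPE+ does compute a policy. -/
def Computed {S A : Type*} [Fintype S] [Fintype A] [DecidableEq S] [DecidableEq A]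
    {H : ℕ} (M : CMDP S A H) (K K₀ : ℕ) (δ : ℝ) {k : ℕ} (w : Hist S A H k) : Prop :=
  k < K₀ ∨ (feasibleSet M.init M.budget K δ w).Nonempty

/-- Zero-mean `1/2`-sub-Gaussian noise distributions: `𝔼 exp(t ζ) ≤ exp(t² / 4)`. -/
def IsNoise (ν : Measure ℝ) : Prop :=
  IsProbabilityMeasure ν ∧ ∫ x, x ∂ν = 0 ∧ HasSubgaussianMGF (fun x : ℝ => x) (1 / 2) ν

section Run

variable {S A : Type*} [Fintype S] [Fintype A] [DecidableEq S] [DecidableEq A]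
  [MeasurableSpace S] [MeasurableSpace A] {H : ℕ}

/-- Law of the trajectory of an episode in which `π` is played. -/
def trajLaw (M : CMDP S A H) (π : Pol S A H) : Measure (Traj S A H) :=
  ∑ τ : Traj S A H, ENNReal.ofReal (trajProb M.init π M.trans τ) • Measure.dirac τ

/-- What is recorded for a trajectory `τ` and noise tables `ζ^f`, `ζ^g`. -/
def observe (M : CMDP S A H)
    (x : Traj S A H × ((S × A × Fin H → ℝ) × (S × A × Fin H → ℝ))) : Episode S A H :=
  (x.1,
    fun h => M.reward (x.1.1 h.castSucc) (x.1.2 h) h + x.2.1 (x.1.1 h.castSucc, x.1.2 h, h),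
    fun h => M.cost (x.1.1 h.castSucc) (x.1.2 h) h + x.2.2 (x.1.1 h.castSucc, x.1.2 h, h))

/-- Law of the record of an episode in which `π` is played: the noise variables `ζ^f(s, a, h)`,
`ζ^g(s, a, h)`, with distributions `νf (s, a, h)`, `νg (s, a, h)`, are independent of each other
and of the trajectory. -/
def episodeLaw (M : CMDP S A H) (νf νg : S × A × Fin H → Measure ℝ) (π : Pol S A H) :
    Measure (Episode S A H) :=
  ((trajLaw M π).prod ((Measure.pi νf).prod (Measure.pi νg))).map (observe M)

/-- Law of the records of the first `k` episodes when the learner `L` interacts with `M`. -/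
def runLaw (M : CMDP S A H) (νf νg : ℕ → S × A × Fin H → Measure ℝ) (L : Learner S A H) :
    (k : ℕ) → Measure (Hist S A H k)
  | 0 => Measure.dirac (fun j => j.elim0)
  | k + 1 => (runLaw M νf νg L k).bind fun w =>
      (episodeLaw M (νf k) (νg k) (L.policy k w)).map fun e =>
        (Fin.snoc w e : Hist S A H (k + 1))

end Run

/-- The policy played in episode `k + 1` of a run with records `ω`. -/
def playedPolicy {S A : Type*} [Fintype A] [MeasurableSpace S] [MeasurableSpace A] {H K : ℕ}
    (L : Learner S A H) (ω : Hist S A H K) (k : Fin K) : Pol S A H :=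
  L.policy k (Fin.take k k.isLt.le ω)

/-- The hard constraint violation of `K` policies. -/
def violation {S A : Type*} [Fintype S] [Fintype A] [DecidableEq S] [DecidableEq A] {H K : ℕ}
    (M : CMDP S A H) (π : Fin K → Pol S A H) : ℝ :=
  ∑ k, max 0 (value M.init (π k) M.cost M.trans - M.budget)

end DOPEPlus

end

namespace DOPEPlus

set_option linter.unusedSectionVars false

/-! ### Expectations along trajectories, by integrating out one step at a time. -/

section Trajectories

variable {S A : Type*} [Fintype S] [Fintype A] [DecidableEq S] [DecidableEq A] {H : ℕ}

/-! Everything happens on the event that, in all `K` episodes, `|ḡ - g| ≤ R` and the true kernel `P`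
lies in the confidence set. There an optimal pair `(π, Q)` of the LP satisfies `V(g, P) ≤ V(g + U,
Q) ≤ V(ĝ, Q) ≤ C̄`, which is safety. Moreover `(π_b, P)` is feasible as soon as `V(g + 2R + U, P) ≤
C̄` for `π_b`, because `ĝ ≤ g + 2R + U`.

The first inequality is `value_le_value_add_bonusU`: the pessimism `U` pays for the difference of
any two kernels in the confidence set. By `value_sub_value`, that difference is the mean along `Q`
of the one-step errors `(P - Q) V_{h+1}`. Membership in the confidence set gives `|P - Q| ≤ 4 √Q u +
23 u²` with `u² = L / D`, and AM-GM (`abs_sum_sub_mul_le`) turns this into `θ` times a variance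
under `Q` plus a multiple of `u²`. The variances are those of a value function of `P` along
trajectories of `Q`, so the law of total variance holds only up to the model error itself: their sum
is at most `H²/2 + H X`, with `X` the expected total absolute error (`value_nextVar_le`). For `θ H ≤
1/2` the occurrence of `X` on the right is absorbed, and a suitable `θ` reproduces the constants of
`U`.

The event has probability at least `1 - 4δ` (`exists_confidence_event`). Visits occur at random,
policy-dependent episodes, so for each triple `(s, a, h)` and each `n` an exponential
supermartingale collects the first `n` visits and then stays frozen (`runLaw_sum_visit_ge_le`). The
transition radius depends on the empirical frequency, whereas the tilt must be fixed beforehand;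
`exists_tilt_upper` and `exists_tilt_lower` choose it at the extreme bad count. -/

lemma sum_traj_succ (Φ : Traj S A (H + 1) → ℝ) :
    ∑ τ, Φ τ = ∑ τ : Traj S A H, ∑ a, ∑ s',
      Φ ((Fin.snoc τ.1 s' : Fin (H + 1 + 1) → S), (Fin.snoc τ.2 a : Fin (H + 1) → A)) := by
  rw [Fintype.sum_prod_type, ← (Fin.snocEquiv fun _ : Fin (H + 1 + 1) => S).sum_comp,
    Fintype.sum_prod_type, Fintype.sum_prod_type, Finset.sum_comm]
  refine Finset.sum_congr rfl fun u _ => ?_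
  have h : ∀ y : S, ∑ v : Fin (H + 1) → A, Φ ((Fin.snocEquiv fun _ => S) (y, u), v)
      = ∑ a, ∑ v : Fin H → A, Φ ((Fin.snoc u y : Fin (H + 1 + 1) → S),
        (Fin.snoc v a : Fin (H + 1) → A)) := fun y => by
    rw [← (Fin.snocEquiv fun _ : Fin (H + 1) => A).sum_comp, Fintype.sum_prod_type]
    rfl
  rw [Finset.sum_congr rfl fun y _ => h y, Finset.sum_comm]
  conv_rhs => rw [Finset.sum_comm]
  exact Finset.sum_congr rfl fun a _ => Finset.sum_comm

lemma sum_traj_zero (Φ : Traj S A 0 → ℝ) :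
    ∑ τ, Φ τ = ∑ s, Φ ((fun _ => s), (fun h => h.elim0)) := by
  rw [Fintype.sum_prod_type, ← Equiv.sum_comp (Equiv.funUnique (Fin 1) S).symm]
  refine Finset.sum_congr rfl fun s _ => ?_
  rw [Fintype.sum_unique]
  exact congrArg _ (Prod.ext rfl (Subsingleton.elim _ _))

lemma trajProb_snoc (p : S → ℝ) (π : Pol S A (H + 1)) (Q : Ker S A (H + 1)) (τ : Traj S A H)
    (a : A) (s' : S) :
    trajProb p π Q ((Fin.snoc τ.1 s' : Fin (H + 1 + 1) → S), (Fin.snoc τ.2 a : Fin (H + 1) → A))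
      = trajProb p (fun s h => π s h.castSucc) (fun s a h => Q s a h.castSucc) τ
        * (π (τ.1 (Fin.last H)) (Fin.last H) a
          * Q (τ.1 (Fin.last H)) a (Fin.last H) s') := by
  have h0 : (Fin.snoc τ.1 s' : Fin (H + 1 + 1) → S) 0 = τ.1 0 :=
    Fin.snoc_castSucc (α := fun _ => S) s' τ.1 0
  simp only [trajProb, Fin.prod_univ_castSucc, Fin.snoc_castSucc, Fin.snoc_last, h0,
    Fin.succ_last, Fin.succ_castSucc]
  ring

/-- The Markov property at step `h`. Induction on the horizon: at the last step the two new factors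
are the conditional law itself, and at an earlier step they sum to one. -/
lemma sum_trajProb_mul_step (p : S → ℝ) {π : Pol S A H} {Q : Ker S A H} (hπ : IsPolicy π)
    (hQ : IsKernel Q) (h : Fin H) (F : S → A → S → ℝ) :
    ∑ τ : Traj S A H, trajProb p π Q τ * F (τ.1 h.castSucc) (τ.2 h) (τ.1 h.succ)
      = ∑ τ : Traj S A H, trajProb p π Q τ
        * ∑ a, π (τ.1 h.castSucc) h a * ∑ s', Q (τ.1 h.castSucc) a h s'
          * F (τ.1 h.castSucc) a s' := by
  induction H with
  | zero => exact h.elim0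
  | succ H ih =>
    rw [sum_traj_succ, sum_traj_succ]
    simp only [trajProb_snoc]
    have hone : ∀ s h, ∑ a, ∑ s', π s h a * Q s a h s' = 1 := by
      intro s h
      simp_rw [← Finset.mul_sum, (hQ _ _ _).2, mul_one, (hπ _ _).2]
    have key : ∀ Ψ : Traj S A H → ℝ, ∑ τ : Traj S A H, ∑ a, ∑ s',
        trajProb p (fun s h => π s h.castSucc) (fun s a h => Q s a h.castSucc) τ
          * (π (τ.1 (Fin.last H)) (Fin.last H) a * Q (τ.1 (Fin.last H)) a (Fin.last H) s') * Ψ τ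
        = ∑ τ : Traj S A H,
          trajProb p (fun s h => π s h.castSucc) (fun s a h => Q s a h.castSucc) τ * Ψ τ := by
      intro Ψ
      refine Finset.sum_congr rfl fun τ _ => ?_
      simp_rw [← Finset.sum_mul, ← Finset.mul_sum]
      rw [show (∑ a, π (τ.1 (Fin.last H)) (Fin.last H) a
        * ∑ s', Q (τ.1 (Fin.last H)) a (Fin.last H) s') = 1 by
          simp_rw [Finset.mul_sum]; exact hone _ _, mul_one]
    induction h using Fin.lastCases with
    | last =>
      simp only [Fin.snoc_castSucc, Fin.snoc_last, Fin.succ_last]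
      rw [key (fun τ => ∑ a, π (τ.1 (Fin.last H)) (Fin.last H) a
          * ∑ s', Q (τ.1 (Fin.last H)) a (Fin.last H) s' * F (τ.1 (Fin.last H)) a s')]
      refine Finset.sum_congr rfl fun τ _ => ?_
      simp_rw [Finset.mul_sum]
      exact Finset.sum_congr rfl fun a _ => Finset.sum_congr rfl fun s' _ => by ring
    | cast h =>
      simp only [Fin.snoc_castSucc, Fin.succ_castSucc]
      rw [key (fun τ => F (τ.1 h.castSucc) (τ.2 h) (τ.1 h.succ)),
        key (fun τ => ∑ a, π (τ.1 h.castSucc) h.castSucc a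
          * ∑ s', Q (τ.1 h.castSucc) a h.castSucc s' * F (τ.1 h.castSucc) a s')]
      exact ih (π := fun s h => π s h.castSucc) (Q := fun s a h => Q s a h.castSucc)
        (fun s h => hπ s _) (fun s a h => hQ s a _) h

lemma sum_trajProb_mul_init (p : S → ℝ) {π : Pol S A H} {Q : Ker S A H} (hπ : IsPolicy π)
    (hQ : IsKernel Q) (F : S → ℝ) :
    ∑ τ : Traj S A H, trajProb p π Q τ * F (τ.1 0) = ∑ s, p s * F s := by
  induction H with
  | zero => rw [sum_traj_zero]; simp [trajProb]
  | succ H ih =>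
    rw [sum_traj_succ]
    simp only [trajProb_snoc]
    rw [← ih (π := fun s h => π s h.castSucc) (Q := fun s a h => Q s a h.castSucc)
        (fun s h => hπ s _) (fun s a h => hQ s a _)]
    refine Finset.sum_congr rfl fun τ _ => ?_
    have h0 : ∀ s', (Fin.snoc τ.1 s' : Fin (H + 1 + 1) → S) 0 = τ.1 0 := fun s' =>
      Fin.snoc_castSucc (α := fun _ => S) s' τ.1 0
    simp_rw [h0, ← Finset.sum_mul, ← Finset.mul_sum, (hQ _ _ _).2, mul_one, (hπ _ _).2, mul_one]

lemma trajProb_nonneg {p : S → ℝ} {π : Pol S A H} {Q : Ker S A H}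
    (hp : ∀ s, 0 ≤ p s) (hπ : IsPolicy π) (hQ : IsKernel Q) (τ : Traj S A H) :
    0 ≤ trajProb p π Q τ :=
  mul_nonneg (hp _) (Finset.prod_nonneg fun _ _ => mul_nonneg ((hπ _ _).1 _) ((hQ _ _ _).1 _))

lemma sum_trajProb {p : S → ℝ} {π : Pol S A H} {Q : Ker S A H} (hp : ∑ s, p s = 1)
    (hπ : IsPolicy π) (hQ : IsKernel Q) : ∑ τ : Traj S A H, trajProb p π Q τ = 1 := by
  simpa [hp] using sum_trajProb_mul_init p hπ hQ fun _ => 1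

/-- The expectation of `F(s_h, a_h)` along a trajectory. -/
noncomputable def stepMean (p : S → ℝ) (π : Pol S A H) (Q : Ker S A H) (h : Fin H)
    (F : S → A → ℝ) : ℝ :=
  ∑ τ : Traj S A H, trajProb p π Q τ * F (τ.1 h.castSucc) (τ.2 h)

/-- The expectation of `F(s_i)` along a trajectory. -/
noncomputable def stateMean (p : S → ℝ) (π : Pol S A H) (Q : Ker S A H) (i : Fin (H + 1))
    (F : S → ℝ) : ℝ :=
  ∑ τ : Traj S A H, trajProb p π Q τ * F (τ.1 i)

lemma value_eq_sum_stepMean (p : S → ℝ) (π : Pol S A H) (ℓ : Fn S A H) (Q : Ker S A H) :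
    value p π ℓ Q = ∑ h, stepMean p π Q h fun s a => ℓ s a h := by
  simp only [value, stepMean, Finset.mul_sum]
  exact Finset.sum_comm

lemma stepMean_eq_stateMean (p : S → ℝ) {π : Pol S A H} {Q : Ker S A H} (hπ : IsPolicy π)
    (hQ : IsKernel Q) (h : Fin H) (F : S → A → ℝ) :
    stepMean p π Q h F = stateMean p π Q h.castSucc fun s => ∑ a, π s h a * F s a := by
  have := sum_trajProb_mul_step p hπ hQ h fun s a _ => F s a
  simpa only [← Finset.sum_mul, (hQ _ _ _).2, one_mul, stepMean, stateMean] using this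

lemma sum_trajProb_mul_step_eq_stepMean (p : S → ℝ) {π : Pol S A H} {Q : Ker S A H}
    (hπ : IsPolicy π) (hQ : IsKernel Q) (h : Fin H) (F : S → A → S → ℝ) :
    ∑ τ : Traj S A H, trajProb p π Q τ * F (τ.1 h.castSucc) (τ.2 h) (τ.1 h.succ)
      = stepMean p π Q h fun s a => ∑ s', Q s a h s' * F s a s' := by
  rw [stepMean_eq_stateMean p hπ hQ]
  exact sum_trajProb_mul_step p hπ hQ h F

lemma stateMean_succ (p : S → ℝ) {π : Pol S A H} {Q : Ker S A H} (hπ : IsPolicy π)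
    (hQ : IsKernel Q) (h : Fin H) (F : S → ℝ) :
    stateMean p π Q h.succ F = stepMean p π Q h fun s a => ∑ s', Q s a h s' * F s' :=
  sum_trajProb_mul_step_eq_stepMean p hπ hQ h fun _ _ s' => F s'

lemma stateMean_mono {p : S → ℝ} {π : Pol S A H} {Q : Ker S A H} (hp : ∀ s, 0 ≤ p s)
    (hπ : IsPolicy π) (hQ : IsKernel Q) (i : Fin (H + 1)) {F G : S → ℝ} (hFG : ∀ s, F s ≤ G s) :
    stateMean p π Q i F ≤ stateMean p π Q i G :=
  Finset.sum_le_sum fun τ _ =>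
    mul_le_mul_of_nonneg_left (hFG _) (trajProb_nonneg hp hπ hQ τ)

lemma value_mono {p : S → ℝ} {π : Pol S A H} {Q : Ker S A H} (hp : ∀ s, 0 ≤ p s)
    (hπ : IsPolicy π) (hQ : IsKernel Q) {ℓ ℓ' : Fn S A H} (h : ∀ s a h, ℓ s a h ≤ ℓ' s a h) :
    value p π ℓ Q ≤ value p π ℓ' Q :=
  Finset.sum_le_sum fun τ _ => mul_le_mul_of_nonneg_left
    (Finset.sum_le_sum fun _ _ => h _ _ _) (trajProb_nonneg hp hπ hQ τ)

lemma value_add (p : S → ℝ) (π : Pol S A H) (Q : Ker S A H) (ℓ ℓ' : Fn S A H) :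
    value p π (fun s a h => ℓ s a h + ℓ' s a h) Q = value p π ℓ Q + value p π ℓ' Q := by
  simp [value, Finset.sum_add_distrib, mul_add]

lemma value_sub (p : S → ℝ) (π : Pol S A H) (Q : Ker S A H) (ℓ ℓ' : Fn S A H) :
    value p π (fun s a h => ℓ s a h - ℓ' s a h) Q = value p π ℓ Q - value p π ℓ' Q := by
  simp [value, Finset.sum_sub_distrib, mul_sub]

lemma value_smul (p : S → ℝ) (π : Pol S A H) (Q : Ker S A H) (c : ℝ) (ℓ : Fn S A H) :
    value p π (fun s a h => c * ℓ s a h) Q = c * value p π ℓ Q := by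
  simp only [value, ← Finset.mul_sum]
  rw [Finset.mul_sum]
  exact Finset.sum_congr rfl fun _ _ => by ring

lemma value_const {p : S → ℝ} {π : Pol S A H} {Q : Ker S A H} (hp : ∑ s, p s = 1)
    (hπ : IsPolicy π) (hQ : IsKernel Q) (c : ℝ) :
    value p π (fun _ _ _ => c) Q = H * c := by
  simp [value, ← Finset.sum_mul, sum_trajProb hp hπ hQ]

/-- Expected increments of a function of the current state add up to the difference of its final
and initial means. -/
lemma value_increment {p : S → ℝ} {π : Pol S A H} {Q : Ker S A H} (hπ : IsPolicy π)
    (hQ : IsKernel Q) (W : Fin (H + 1) → S → ℝ) :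
    value p π (fun s a h => ∑ s', Q s a h s' * W h.succ s') Q
      - ∑ h : Fin H, stateMean p π Q h.castSucc (W h.castSucc)
      = stateMean p π Q (Fin.last H) (W (Fin.last H)) - ∑ s, p s * W 0 s := by
  rw [value_eq_sum_stepMean]
  have h1 : ∀ h : Fin H, stepMean p π Q h (fun s a => ∑ s', Q s a h s' * W h.succ s')
      = stateMean p π Q h.succ (W h.succ) := fun h => (stateMean_succ p hπ hQ h _).symm
  -- The sum over all `H + 1` times, split off once at the end and once at the start, telescopes.
  have h2 := Fin.sum_univ_castSucc fun i => stateMean p π Q i (W i)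
  have h3 := Fin.sum_univ_succ fun i => stateMean p π Q i (W i)
  have h4 : stateMean p π Q 0 (W 0) = ∑ s, p s * W 0 s := sum_trajProb_mul_init p hπ hQ (W 0)
  simp_rw [h1]
  linarith

end Trajectories

/-! ### Simulation lemma, total variance and the expected model error. -/

section Simulation

variable {S A : Type*} [Fintype S] [Fintype A] [DecidableEq S] [DecidableEq A] {H : ℕ}

/-- The value functions `V_h^π(ℓ, P)`, defined backwards from `V_{H+1} = 0`. -/
noncomputable def valueFn (π : Pol S A H) (ℓ : Fn S A H) (P : Ker S A H) : Fin (H + 1) → S → ℝ :=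
  Fin.reverseInduction (motive := fun _ => S → ℝ) (fun _ => 0)
    fun h V s => ∑ a, π s h a * (ℓ s a h + ∑ s', P s a h s' * V s')

@[simp]
lemma valueFn_last (π : Pol S A H) (ℓ : Fn S A H) (P : Ker S A H) (s : S) :
    valueFn π ℓ P (Fin.last H) s = 0 := by
  simp [valueFn]

lemma valueFn_castSucc (π : Pol S A H) (ℓ : Fn S A H) (P : Ker S A H) (h : Fin H) (s : S) :
    valueFn π ℓ P h.castSucc s
      = ∑ a, π s h a * (ℓ s a h + ∑ s', P s a h s' * valueFn π ℓ P h.succ s') := by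
  simp [valueFn]

lemma abs_sum_mul_le {ι : Type*} [Fintype ι] {q x : ι → ℝ} {c : ℝ} (hq : ∀ i, 0 ≤ q i)
    (hq1 : ∑ i, q i = 1) (hx : ∀ i, |x i| ≤ c) : |∑ i, q i * x i| ≤ c :=
  calc |∑ i, q i * x i| ≤ ∑ i, |q i * x i| := Finset.abs_sum_le_sum_abs _ _
    _ ≤ ∑ i, q i * c := Finset.sum_le_sum fun i _ => by
        rw [abs_mul, abs_of_nonneg (hq i)]
        exact mul_le_mul_of_nonneg_left (hx i) (hq i)
    _ = c := by rw [← Finset.sum_mul, hq1, one_mul]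

lemma abs_valueFn_le {π : Pol S A H} {ℓ : Fn S A H} {P : Ker S A H} (hπ : IsPolicy π)
    (hP : IsKernel P) (hℓ : ∀ s a h, |ℓ s a h| ≤ 1 / 2) (i : Fin (H + 1)) (s : S) :
    |valueFn π ℓ P i s| ≤ ((H : ℝ) - i) / 2 := by
  induction i using Fin.reverseInduction generalizing s with
  | last => simp
  | cast h ih =>
    rw [valueFn_castSucc]
    refine abs_sum_mul_le (hπ s h).1 (hπ s h).2 fun a => ?_
    have h1 := abs_sum_mul_le (hP s a h).1 (hP s a h).2 ih
    have h2 := (abs_add_le (ℓ s a h) _).trans (add_le_add (hℓ s a h) h1)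
    refine h2.trans (le_of_eq ?_)
    simp only [Fin.val_succ, Fin.val_castSucc]
    push_cast
    ring

/-- The Bellman equation of `P`, averaged along trajectories of another kernel `Q`. -/
lemma sum_stateMean_valueFn {p : S → ℝ} {π : Pol S A H} {ℓ : Fn S A H} {P Q : Ker S A H}
    (hπ : IsPolicy π) (hQ : IsKernel Q) :
    ∑ h : Fin H, stateMean p π Q h.castSucc (valueFn π ℓ P h.castSucc)
      = value p π ℓ Q
        + value p π (fun s a h => ∑ s', P s a h s' * valueFn π ℓ P h.succ s') Q := by
  rw [← value_add, value_eq_sum_stepMean]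
  refine Finset.sum_congr rfl fun h _ => ?_
  rw [stepMean_eq_stateMean p hπ hQ]
  exact congrArg _ (funext fun s => valueFn_castSucc π ℓ P h s)

lemma value_eq_sum_valueFn {p : S → ℝ} {π : Pol S A H} (ℓ : Fn S A H) {P : Ker S A H}
    (hπ : IsPolicy π) (hP : IsKernel P) :
    value p π ℓ P = ∑ s, p s * valueFn π ℓ P 0 s := by
  have h1 := value_increment (p := p) hπ hP (valueFn π ℓ P)
  have h2 := sum_stateMean_valueFn (p := p) (ℓ := ℓ) (P := P) hπ hP
  have h3 : stateMean p π P (Fin.last H) (valueFn π ℓ P (Fin.last H)) = 0 := by simp [stateMean]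
  linarith

/-- The simulation lemma: the difference of the values under two kernels. -/
lemma value_sub_value {p : S → ℝ} {π : Pol S A H} (ℓ : Fn S A H) {P Q : Ker S A H}
    (hπ : IsPolicy π) (hP : IsKernel P) (hQ : IsKernel Q) :
    value p π ℓ P - value p π ℓ Q
      = value p π (fun s a h => ∑ s', (P s a h s' - Q s a h s') * valueFn π ℓ P h.succ s') Q := by
  -- Telescoping `V^P` along `Q`: the dynamics contribute `Q V_{h+1}`, the Bellman equation
  -- contributes `ℓ + P V_{h+1}`.
  have h1 := value_increment (p := p) hπ hQ (valueFn π ℓ P)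
  have h2 := sum_stateMean_valueFn (p := p) (ℓ := ℓ) (P := P) hπ hQ
  have h3 : stateMean p π Q (Fin.last H) (valueFn π ℓ P (Fin.last H)) = 0 := by simp [stateMean]
  have h4 := value_eq_sum_valueFn (p := p) ℓ hπ hP
  simp_rw [sub_mul, Finset.sum_sub_distrib]
  rw [value_sub]
  linarith

/-- The variance of the value function of `P` at the next state, drawn from `Q`. -/
noncomputable def nextVar (π : Pol S A H) (ℓ : Fn S A H) (P Q : Ker S A H) : Fn S A H :=
  fun s a h => ∑ s₁, Q s a h s₁ * valueFn π ℓ P h.succ s₁ ^ 2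
    - (∑ s₁, Q s a h s₁ * valueFn π ℓ P h.succ s₁) ^ 2

/-- The one-step model error `(P - Q) V_{h+1}`. -/
noncomputable def stepErr (π : Pol S A H) (ℓ : Fn S A H) (P Q : Ker S A H) : Fn S A H :=
  fun s a h => ∑ s₁, (P s a h s₁ - Q s a h s₁) * valueFn π ℓ P h.succ s₁

/-- A law of total variance for a value function of one kernel along trajectories of another. -/
lemma value_nextVar_le {p : S → ℝ} {π : Pol S A H} {ℓ : Fn S A H} {P Q : Ker S A H}
    (hp : ∀ s, 0 ≤ p s) (hp1 : ∑ s, p s = 1) (hπ : IsPolicy π) (hP : IsKernel P)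
    (hQ : IsKernel Q) (hℓ : ∀ s a h, |ℓ s a h| ≤ 1 / 2) :
    value p π (nextVar π ℓ P Q) Q
      ≤ H ^ 2 / 2 + H * value p π (fun s a h => |stepErr π ℓ P Q s a h|) Q := by
  set W := valueFn π ℓ P with hW
  -- The squares `W²` telescope; the final term vanishes and the initial one has a favourable sign.
  have h1 := value_increment (p := p) hπ hQ fun i s => W i s ^ 2
  have h3 : stateMean p π Q (Fin.last H) (fun s => W (Fin.last H) s ^ 2) = 0 := by
    simp [stateMean, hW]
  have h4 : 0 ≤ ∑ s, p s * W 0 s ^ 2 :=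
    Finset.sum_nonneg fun s _ => mul_nonneg (hp s) (sq_nonneg _)
  have h5 : ∑ h : Fin H, stateMean p π Q h.castSucc (fun s => W h.castSucc s ^ 2)
      ≤ value p π (fun s a h => (ℓ s a h + ∑ s', P s a h s' * W h.succ s') ^ 2) Q := by
    rw [value_eq_sum_stepMean]
    refine Finset.sum_le_sum fun h _ => ?_
    rw [stepMean_eq_stateMean p hπ hQ]
    refine stateMean_mono hp hπ hQ _ fun s => ?_
    rw [hW, valueFn_castSucc]
    -- Jensen over the action.
    have hJ := (even_two.convexOn_pow (𝕜 := ℝ)).map_sum_le (t := Finset.univ) (w := π s h)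
      (p := fun a => ℓ s a h + ∑ s', P s a h s' * valueFn π ℓ P h.succ s')
      (fun a _ => (hπ s h).1 a) (hπ s h).2 (fun _ _ => Set.mem_univ _)
    simpa only [smul_eq_mul] using hJ
  have h6 : value p π (fun s a h => (ℓ s a h + ∑ s', P s a h s' * W h.succ s') ^ 2
        - (∑ s', Q s a h s' * W h.succ s') ^ 2) Q
      ≤ value p π (fun s a h => (H : ℝ) / 2 + H * |stepErr π ℓ P Q s a h|) Q := by
    refine value_mono hp hπ hQ fun s a h => ?_
    have hWb : ∀ s', |W h.succ s'| ≤ ((H : ℝ) - 1) / 2 := fun s' => by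
      refine (abs_valueFn_le hπ hP hℓ h.succ s').trans ?_
      simp only [Fin.val_succ]
      push_cast
      have : (0 : ℝ) ≤ (h : ℕ) := Nat.cast_nonneg _
      linarith
    have hPW := abs_sum_mul_le (hP s a h).1 (hP s a h).2 hWb
    have hQW := abs_sum_mul_le (hQ s a h).1 (hQ s a h).2 hWb
    have herr : stepErr π ℓ P Q s a h
        = ∑ s', P s a h s' * W h.succ s' - ∑ s', Q s a h s' * W h.succ s' := by
      simp only [stepErr, sub_mul, Finset.sum_sub_distrib, hW]
    rw [herr]
    set x := ∑ s', P s a h s' * W h.succ s'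
    set y := ∑ s', Q s a h s' * W h.succ s'
    have hl := hℓ s a h
    have hsum : |ℓ s a h + x + y| ≤ H := by
      have := abs_add_le (ℓ s a h + x) y
      have := abs_add_le (ℓ s a h) x
      linarith
    have hdiff : |ℓ s a h + x - y| ≤ 1 / 2 + |x - y| := by
      have := abs_add_le (ℓ s a h) (x - y)
      rw [add_sub_assoc]
      linarith
    -- With `P = Q` one would have `x = y`; the discrepancy `x - y` is exactly the model error. The
    -- centring `|ℓ| ≤ 1/2` makes the second factor at most `H`.
    calc (ℓ s a h + x) ^ 2 - y ^ 2 = (ℓ s a h + x - y) * (ℓ s a h + x + y) := by ring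
      _ ≤ |(ℓ s a h + x - y) * (ℓ s a h + x + y)| := le_abs_self _
      _ ≤ (1 / 2 + |x - y|) * H := by
          rw [abs_mul]
          exact mul_le_mul hdiff hsum (abs_nonneg _) (by positivity)
      _ = _ := by ring
  rw [value_sub] at h6
  rw [value_add p π Q (fun _ _ _ => (H : ℝ) / 2), value_const hp1 hπ hQ, value_smul] at h6
  have h7 : value p π (nextVar π ℓ P Q) Q
      = value p π (fun s a h => ∑ s', Q s a h s' * W h.succ s' ^ 2) Q
        - value p π (fun s a h => (∑ s', Q s a h s' * W h.succ s') ^ 2) Q := value_sub ..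
  rw [h7]
  linarith

/-- If `|P - Q| ≤ 4 u √Q + 23 u²`, the error `(P - Q) W` is bounded by the variance of `W`
under `Q`. -/
lemma abs_sum_sub_mul_le {ι : Type*} [Fintype ι] {P Q W : ι → ℝ} {u θ B : ℝ}
    (hP1 : ∑ i, P i = 1) (hQ : ∀ i, 0 ≤ Q i) (hQ1 : ∑ i, Q i = 1) (hθ : 0 < θ)
    (hPQ : ∀ i, |P i - Q i| ≤ 4 * Real.sqrt (Q i) * u + 23 * u ^ 2) (hW : ∀ i, |W i| ≤ B / 2) :
    |∑ i, (P i - Q i) * W i| ≤ θ * (∑ i, Q i * W i ^ 2 - (∑ i, Q i * W i) ^ 2)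
      + (4 / θ + 23 * B) * Fintype.card ι * u ^ 2 := by
  set m := ∑ i, Q i * W i with hm
  have hmB : |m| ≤ B / 2 := abs_sum_mul_le hQ hQ1 hW
  -- `P - Q` has total mass zero, so `W` may be centred at its `Q`-mean.
  have h1 : ∑ i, (P i - Q i) * W i = ∑ i, (P i - Q i) * (W i - m) := by
    simp_rw [mul_sub, Finset.sum_sub_distrib, ← Finset.sum_mul, Finset.sum_sub_distrib]
    rw [hP1, hQ1]; ring
  have h2 : ∑ i, Q i * W i ^ 2 - m ^ 2 = ∑ i, Q i * (W i - m) ^ 2 := by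
    have : ∀ i, Q i * (W i - m) ^ 2 = Q i * W i ^ 2 - 2 * m * (Q i * W i) + Q i * m ^ 2 :=
      fun i => by ring
    simp_rw [this, Finset.sum_add_distrib, Finset.sum_sub_distrib, ← Finset.mul_sum,
      ← Finset.sum_mul]
    rw [← hm, hQ1]; ring
  rw [h1, h2]
  calc |∑ i, (P i - Q i) * (W i - m)| ≤ ∑ i, |(P i - Q i) * (W i - m)| :=
        Finset.abs_sum_le_sum_abs _ _
    _ ≤ ∑ i, (θ * (Q i * (W i - m) ^ 2) + (4 / θ + 23 * B) * u ^ 2) := by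
        refine Finset.sum_le_sum fun i _ => ?_
        have hd : |W i - m| ≤ B := by
          have := abs_sub (W i) m
          linarith [hW i]
        have hs := Real.sq_sqrt (hQ i)
        set q := Real.sqrt (Q i)
        set d := |W i - m| with hd'
        have hdsq : (W i - m) ^ 2 = d ^ 2 := (sq_abs _).symm
        have hd0 : 0 ≤ d := abs_nonneg _
        rw [abs_mul, hdsq, ← hd']
        have e1 : |P i - Q i| * d ≤ (4 * q * u + 23 * u ^ 2) * d :=
          mul_le_mul_of_nonneg_right (hPQ i) hd0
        have e2 : 23 * u ^ 2 * d ≤ 23 * u ^ 2 * B := by gcongr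
        have e3 : 4 * q * u * d ≤ θ * (q ^ 2 * d ^ 2) + 4 / θ * u ^ 2 := by
          have : θ * (q ^ 2 * d ^ 2) + 4 / θ * u ^ 2 - 4 * q * u * d
              = (θ * (q * d) - 2 * u) ^ 2 / θ := by
            field_simp; ring
          have h0 : 0 ≤ (θ * (q * d) - 2 * u) ^ 2 / θ := by positivity
          linarith
        rw [hs] at e3
        linarith
    _ = _ := by
        rw [Finset.sum_add_distrib, ← Finset.mul_sum, Finset.sum_const, Finset.card_univ,
          nsmul_eq_mul]
        ring

/-- The expected model error is bounded by any pessimism term `c + b / D` whose constants balance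
the variance. -/
lemma value_abs_stepErr_le {p : S → ℝ} {π : Pol S A H} {ℓ : Fn S A H} {P Q : Ker S A H}
    (hp : ∀ s, 0 ≤ p s) (hp1 : ∑ s, p s = 1) (hπ : IsPolicy π) (hP : IsKernel P)
    (hQ : IsKernel Q) (hℓ : ∀ s a h, |ℓ s a h| ≤ 1 / 2) {u : Fn S A H}
    (hPQ : ∀ s a h s', |P s a h s' - Q s a h s'|
      ≤ 4 * Real.sqrt (Q s a h s') * u s a h + 23 * u s a h ^ 2)
    {θ : ℝ} (hθ : 0 < θ) (hθH : θ * H ≤ 1 / 2) :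
    value p π (fun s a h => |stepErr π ℓ P Q s a h|) Q
      ≤ value p π (fun s a h => θ * H
        + (8 / θ + 46 * H) * Fintype.card S * u s a h ^ 2) Q := by
  have hvar := value_nextVar_le hp hp1 hπ hP hQ hℓ
  have hpt : value p π (fun s a h => |stepErr π ℓ P Q s a h|) Q
      ≤ value p π (fun s a h => θ * nextVar π ℓ P Q s a h
        + (4 / θ + 23 * H) * Fintype.card S * u s a h ^ 2) Q := by
    refine value_mono hp hπ hQ fun s a h => ?_
    refine abs_sum_sub_mul_le (hP s a h).2 (hQ s a h).1 (hQ s a h).2 hθ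
      (hPQ s a h) fun s' => (abs_valueFn_le hπ hP hℓ h.succ s').trans ?_
    have : (0 : ℝ) ≤ (h.succ : Fin (H + 1)).val := Nat.cast_nonneg _
    linarith
  have hX0 : 0 ≤ value p π (fun s a h => |stepErr π ℓ P Q s a h|) Q := by
    have := value_mono hp hπ hQ (ℓ := fun _ _ _ => 0)
      (ℓ' := fun s a h => |stepErr π ℓ P Q s a h|) fun s a h => abs_nonneg _
    rwa [value_const hp1 hπ hQ, mul_zero] at this
  rw [value_add, value_smul, value_smul] at hpt
  rw [value_add p π Q (fun _ _ _ => θ * H), value_const hp1 hπ hQ, value_smul]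
  set X := value p π (fun s a h => |stepErr π ℓ P Q s a h|) Q
  set x := value p π (fun s a h => u s a h ^ 2) Q
  have h1 : θ * value p π (nextVar π ℓ P Q) Q ≤ θ * (H ^ 2 / 2 + H * X) :=
    mul_le_mul_of_nonneg_left hvar hθ.le
  -- Half of `X` is absorbed on the left, which doubles the remaining terms.
  have h2 : θ * H * X ≤ 1 / 2 * X := mul_le_mul_of_nonneg_right hθH hX0
  have h3 : (8 / θ + 46 * (H : ℝ)) * Fintype.card S * x
    = 2 * ((4 / θ + 23 * H) * Fintype.card S * x) := by ring
  nlinarith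

end Simulation

/-! ### The extra pessimism dominates the model error. -/

section Pessimism

variable {S A : Type*} [Fintype S] [Fintype A] [DecidableEq S] [DecidableEq A] {H k : ℕ}

/-- Replaces the empirical frequency `r` in the radius by the probability `y`, so that the variance
under a genuine kernel can appear. -/
lemma abs_sub_le_of_abs_sub_le_radius {x y r u : ℝ} (hy : 0 ≤ y) (hr : 0 ≤ r) (hu : 0 ≤ u)
    (hx : |x - r| ≤ 2 * (Real.sqrt r * u) + 14 / 3 * u ^ 2)
    (hyr : |y - r| ≤ 2 * (Real.sqrt r * u) + 14 / 3 * u ^ 2) :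
    |x - y| ≤ 4 * Real.sqrt y * u + 23 * u ^ 2 := by
  have ht := Real.sq_sqrt hr
  have hw := Real.sq_sqrt hy
  have ht0 := Real.sqrt_nonneg r
  have hw0 := Real.sqrt_nonneg y
  set t := Real.sqrt r
  set w := Real.sqrt y
  -- Otherwise `t (t - 2u) > w² + (17/5)(7/5) u²`, and `4.76 > 14/3` contradicts `hyr`. The final
  -- constant is `4 · 17/5 + 2 · 14/3 < 23`.
  have key : t ≤ w + 17 / 5 * u := by
    by_contra! hlt
    have h1 := (abs_le.1 hyr).1
    have h2 : (w + 17 / 5 * u) * (w + 7 / 5 * u) ≤ t * (t - 2 * u) :=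
      mul_le_mul hlt.le (by linarith) (by positivity) ht0
    have h3 : 0 ≤ w * u := mul_nonneg hw0 hu
    rcases hu.eq_or_lt with rfl | hu'
    · nlinarith
    · nlinarith [sq_pos_of_pos hu']
  have h1 : t * u ≤ (w + 17 / 5 * u) * u := mul_le_mul_of_nonneg_right key hu
  have h2 : |x - y| ≤ |x - r| + |y - r| := by
    have := abs_sub_le x r y
    rwa [abs_sub_comm r y] at this
  nlinarith [sq_nonneg u]

lemma one_le_den (w : Hist S A H k) (s : S) (a : A) (h : Fin H) : 1 ≤ den w s a h :=
  le_max_left _ _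

lemma empKer_nonneg (w : Hist S A H k) (s : S) (a : A) (h : Fin H) (s' : S) :
    0 ≤ empKer w s a h s' := by
  unfold empKer
  positivity

lemma radiusKer_eq {K : ℕ} {δ : ℝ} (hL : 0 ≤ logTerm S A H K δ) (w : Hist S A H k) (s : S)
    (a : A) (h : Fin H) (s' : S) :
    radiusKer K δ w s a h s'
      = 2 * (Real.sqrt (empKer w s a h s') * Real.sqrt (logTerm S A H K δ / den w s a h))
        + 14 / 3 * Real.sqrt (logTerm S A H K δ / den w s a h) ^ 2 := by
  have hD : 0 < den w s a h := one_pos.trans_le (one_le_den w s a h)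
  rw [Real.sq_sqrt (div_nonneg hL hD.le), ← Real.sqrt_mul (empKer_nonneg w s a h s')]
  simp only [radiusKer]
  rw [mul_div_assoc]
  congr 1
  field_simp

/-- The `10⁴ H² S² L²` part of `η` suffices, since `H S L ≥ 1`. Here `62 = 16 + 46` comes from `8 /
θ + 46 H` at `θ = 1 / (2H)`. -/
lemma le_eta {K : ℕ} {δ : ℝ} (hL : 1 ≤ logTerm S A H K δ) (hH : 1 ≤ H)
    (hS : 1 ≤ Fintype.card S) :
    62 * (H : ℝ) * Fintype.card S * logTerm S A H K δ ≤ eta S A H K δ := by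
  have hH' : (1 : ℝ) ≤ H := by exact_mod_cast hH
  have hS' : (1 : ℝ) ≤ Fintype.card S := by exact_mod_cast hS
  unfold eta
  set L := logTerm S A H K δ
  set s : ℝ := (Fintype.card S : ℝ)
  set x : ℝ := H * s * L with hx
  have hx1 : 1 ≤ x := one_le_mul_of_one_le_of_one_le (one_le_mul_of_one_le_of_one_le hH' hS') hL
  have h1 : 0 ≤ (19 * (H : ℝ) * s + 2 * (H : ℝ) ^ (3 / 2 : ℝ) * s) * L ^ 2 := by positivity
  have h2 : x ≤ x ^ 2 := by nlinarith
  calc 62 * (H : ℝ) * s * L = 62 * x := by rw [hx]; ring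
    _ ≤ 10 ^ 4 * x ^ 2 := by nlinarith
    _ ≤ 10 ^ 4 * x ^ 2 + (19 * (H : ℝ) * s + 2 * (H : ℝ) ^ (3 / 2 : ℝ) * s) * L ^ 2 := by linarith
    _ = _ := by rw [hx]; ring

lemma varEps_nonneg {K : ℕ} {δ : ℝ} (hL : 0 ≤ logTerm S A H K δ) (w : Hist S A H k) (s : S)
    (a : A) (h : Fin H) : 0 ≤ varEps K δ w s a h := by
  have hD : 0 < den w s a h := one_pos.trans_le (one_le_den w s a h)
  unfold varEps
  positivity

/-- The extra pessimism `U` outweighs the model error of any two kernels in the confidence set. -/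
theorem value_le_value_add_bonusU {p : S → ℝ} (hp : ∀ s, 0 ≤ p s) (hp1 : ∑ s, p s = 1)
    {π : Pol S A H} (hπ : IsPolicy π) {g : Fn S A H} (hg : ∀ s a h, g s a h ∈ Set.Icc (0 : ℝ) 1)
    {K : ℕ} {δ : ℝ} (hL : 1 ≤ logTerm S A H K δ) (hH : 1 ≤ H) (hS : 1 ≤ Fintype.card S)
    (hA : 1 ≤ Fintype.card A) (hK : 1 ≤ K) {w : Hist S A H k} {P Q : Ker S A H}
    (hP : P ∈ confSet K δ w) (hQ : Q ∈ confSet K δ w) :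
    value p π g P ≤ value p π (fun s a h => g s a h + bonusU K δ w s a h) Q := by
  obtain ⟨hPk, hPd⟩ := hP
  obtain ⟨hQk, hQd⟩ := hQ
  have hL0 : 0 ≤ logTerm S A H K δ := zero_le_one.trans hL
  set L := logTerm S A H K δ with hLdef
  set u : Fn S A H := fun s a h => Real.sqrt (L / den w s a h) with hu
  have hu2 : ∀ s a h, u s a h ^ 2 = L / den w s a h := fun s a h =>
    Real.sq_sqrt (div_nonneg hL0 (zero_le_one.trans (one_le_den w s a h)))
  have hPQ : ∀ s a h s', |P s a h s' - Q s a h s'|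
      ≤ 4 * Real.sqrt (Q s a h s') * u s a h + 23 * u s a h ^ 2 := fun s a h s' => by
    have h1 := hPd s a h s'
    have h2 := hQd s a h s'
    rw [radiusKer_eq hL0] at h1 h2
    exact abs_sub_le_of_abs_sub_le_radius ((hQk s a h).1 s') (empKer_nonneg w s a h s')
      (Real.sqrt_nonneg _) h1 h2
  -- Subtracting `1/2` shifts both values by `H/2` and leaves their difference unchanged.
  set ℓ : Fn S A H := fun s a h => g s a h - 1 / 2 with hℓdef
  have hℓ : ∀ s a h, |ℓ s a h| ≤ 1 / 2 := fun s a h => by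
    rw [abs_le]
    have := hg s a h
    constructor <;> simp only [hℓdef] <;> linarith [this.1, this.2]
  have hshift : ∀ {R : Ker S A H}, IsKernel R → value p π ℓ R = value p π g R - H * (1 / 2) :=
    fun hR => by rw [hℓdef, value_sub p π _ g fun _ _ _ => 1 / 2, value_const hp1 hπ hR]
  have hsim := value_sub_value (p := p) ℓ hπ hPk hQk
  rw [hshift hPk, hshift hQk] at hsim
  have habs : value p π (stepErr π ℓ P Q) Q ≤ value p π (fun s a h => |stepErr π ℓ P Q s a h|) Q :=
    value_mono hp hπ hQk fun s a h => le_abs_self _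
  have hH0 : (0 : ℝ) < H := by exact_mod_cast hH
  have hS0 : (0 : ℝ) < Fintype.card S := by exact_mod_cast hS
  have hA0 : (0 : ℝ) < Fintype.card A := by exact_mod_cast hA
  have hK0 : (0 : ℝ) < K := by exact_mod_cast hK
  set r : ℝ := Real.sqrt ((H : ℝ) * (Fintype.card A : ℝ) / (K : ℝ)) with hr
  have hr0 : 0 < r := Real.sqrt_pos.2 (by positivity)
  have hrr : Real.sqrt ((H : ℝ) * (K : ℝ) / (Fintype.card A : ℝ)) = H / r := by
    rw [eq_div_iff hr0.ne', hr, ← Real.sqrt_mul (by positivity)]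
    rw [show (H : ℝ) * K / Fintype.card A * (H * Fintype.card A / K) = (H : ℝ) ^ 2 by
      field_simp]
    exact Real.sqrt_sq hH0.le
  have heta := le_eta (S := S) (A := A) (H := H) (K := K) (δ := δ) hL hH hS
  rw [← hLdef] at heta
  have hbonus : ∀ s a h, 4 * (Fintype.card S : ℝ) * r
      + (2 * (H / r) * L + eta S A H K δ) / den w s a h ≤ bonusU K δ w s a h := fun s a h => by
    have := varEps_nonneg hL0 w s a h
    simp only [bonusU]
    rw [← hr, hrr, ← hLdef]
    have : 0 ≤ 8 * Real.sqrt (H : ℝ) * varEps K δ w s a h := by positivity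
    linarith
  suffices hmain : value p π (fun s a h => |stepErr π ℓ P Q s a h|) Q
      ≤ value p π (bonusU K δ w) Q by
    rw [value_add]
    have hsim' : value p π g P - (H : ℝ) * (1 / 2) - (value p π g Q - H * (1 / 2))
      = value p π (stepErr π ℓ P Q) Q := hsim
    linarith
  -- The choice `θ H = 4 S r` matches the constant summand of `U`, and then `8 S / θ = 2 H / r`
  -- matches `2 √(HK/A)`. It is admissible only if `4 S r ≤ 1/2`; otherwise `θ H = 1/2` is already
  -- below the constant summand.
  rcases le_or_gt (4 * (Fintype.card S : ℝ) * r) (1 / 2) with hsmall | hlarge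
  · refine (value_abs_stepErr_le hp hp1 hπ hPk hQk hℓ hPQ
      (θ := 4 * (Fintype.card S : ℝ) * r / H) (by positivity) (by field_simp; linarith)).trans ?_
    refine value_mono hp hπ hQk fun s a h => le_trans ?_ (hbonus s a h)
    have hD : 0 < den w s a h := one_pos.trans_le (one_le_den w s a h)
    rw [hu2]
    have e1 : 4 * (Fintype.card S : ℝ) * r / H * H = 4 * (Fintype.card S : ℝ) * r := by field_simp
    have e2 : (8 / (4 * (Fintype.card S : ℝ) * r / H) + 46 * H) * Fintype.card S
        * (L / den w s a h)
        = (2 * (H / r) * L + 46 * H * Fintype.card S * L) / den w s a h := by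
      field_simp; ring
    rw [e1, e2]
    have : 0 ≤ (H : ℝ) * Fintype.card S * L := by positivity
    gcongr
    linarith
  · refine (value_abs_stepErr_le hp hp1 hπ hPk hQk hℓ hPQ
      (θ := 1 / (2 * H)) (by positivity) (by field_simp; norm_num)).trans ?_
    refine value_mono hp hπ hQk fun s a h => le_trans ?_ (hbonus s a h)
    have hD : 0 < den w s a h := one_pos.trans_le (one_le_den w s a h)
    rw [hu2]
    have e1 : 1 / (2 * (H : ℝ)) * H = 1 / 2 := by field_simp
    have e2 : (8 / (1 / (2 * (H : ℝ))) + 46 * H) * Fintype.card S * (L / den w s a h)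
        = (62 * H * Fintype.card S * L) / den w s a h := by
      field_simp; ring
    rw [e1, e2]
    have : 0 ≤ 2 * ((H : ℝ) / r) * L := by positivity
    gcongr
    linarith

end Pessimism

/-! ### The law of a run as iterated conditioning, and exponential supermartingales. -/

section RunLaw

open scoped ENNReal

variable {S A : Type*} [Fintype S] [Fintype A] [DecidableEq S] [DecidableEq A]
  [MeasurableSpace S] [DiscreteMeasurableSpace S] [MeasurableSpace A]
  [DiscreteMeasurableSpace A] {H : ℕ}

lemma measurable_observe (M : CMDP S A H) : Measurable (observe M) := by
  refine measurable_from_prod_countable_right fun τ => ?_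
  unfold observe
  refine Measurable.prodMk measurable_const (Measurable.prodMk ?_ ?_)
  · refine measurable_pi_lambda _ fun h => ?_
    dsimp only
    refine Measurable.const_add ?_ _
    exact (measurable_pi_apply (τ.1 h.castSucc, τ.2 h, h)).comp measurable_fst
  · refine measurable_pi_lambda _ fun h => ?_
    dsimp only
    refine Measurable.const_add ?_ _
    exact (measurable_pi_apply (τ.1 h.castSucc, τ.2 h, h)).comp measurable_snd

lemma lintegral_episodeLaw (M : CMDP S A H) (νf νg : S × A × Fin H → Measure ℝ)
    [∀ i, IsProbabilityMeasure (νf i)] [∀ i, IsProbabilityMeasure (νg i)] (π : Pol S A H)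
    {F : Episode S A H → ℝ≥0∞} (hF : Measurable F) :
    ∫⁻ e, F e ∂episodeLaw M νf νg π
      = ∑ τ : Traj S A H, ENNReal.ofReal (trajProb M.init π M.trans τ)
        * ∫⁻ z, F (observe M (τ, z)) ∂((Measure.pi νf).prod (Measure.pi νg)) := by
  have hm : Measurable fun x => F (observe M x) := hF.comp (measurable_observe M)
  rw [episodeLaw, lintegral_map hF (measurable_observe M),
    lintegral_prod _ hm.aemeasurable, trajLaw, lintegral_finsetSum_measure]
  refine Finset.sum_congr rfl fun τ _ => ?_
  rw [lintegral_smul_measure, lintegral_dirac]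
  rfl

lemma lintegral_episodeLaw_one (M : CMDP S A H) (νf νg : S × A × Fin H → Measure ℝ)
    [∀ i, IsProbabilityMeasure (νf i)] [∀ i, IsProbabilityMeasure (νg i)] {π : Pol S A H}
    (hπ : IsPolicy π) : ∫⁻ _, 1 ∂episodeLaw M νf νg π = 1 := by
  rw [lintegral_episodeLaw M νf νg π measurable_const]
  simp only [lintegral_const, measure_univ, mul_one]
  rw [← ENNReal.ofReal_sum_of_nonneg fun τ _ =>
    trajProb_nonneg M.init_nonneg hπ M.trans_isKernel τ,
    sum_trajProb M.init_sum hπ M.trans_isKernel, ENNReal.ofReal_one]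

lemma measurable_snoc (k : ℕ) : Measurable fun x : Hist S A H k × Episode S A H =>
    (Fin.snoc x.1 x.2 : Hist S A H (k + 1)) := by
  refine measurable_pi_lambda _ fun i => ?_
  induction i using Fin.lastCases with
  | last => simpa only [Fin.snoc_last] using measurable_snd
  | cast i =>
    simp only [Fin.snoc_castSucc]
    exact (measurable_pi_apply i).comp measurable_fst

lemma measurable_snoc_left {k : ℕ} (w : Hist S A H k) : Measurable fun e : Episode S A H =>
    (Fin.snoc w e : Hist S A H (k + 1)) :=
  (measurable_snoc k).comp measurable_prodMk_left

lemma measurable_trajProb_policy (M : CMDP S A H) (L : Learner S A H) (k : ℕ) (τ : Traj S A H) :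
    Measurable fun w => trajProb M.init (L.policy k w) M.trans τ := by
  have hπ : ∀ s h a, Measurable fun w => L.policy k w s h a := fun s h a =>
    (measurable_pi_apply a).comp ((measurable_pi_apply h).comp
      ((measurable_pi_apply s).comp (L.policy_measurable k)))
  unfold trajProb
  exact (Finset.measurable_prod _ fun h _ => (hπ _ _ _).mul_const _).const_mul _

variable (M : CMDP S A H) (νf νg : ℕ → S × A × Fin H → Measure ℝ)
  [∀ k i, IsProbabilityMeasure (νf k i)] [∀ k i, IsProbabilityMeasure (νg k i)]
  (L : Learner S A H)

/-- The history enters the episode law only through the finitely many trajectory probabilities,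
which are measurable in it. -/
lemma measurable_map_snoc (k : ℕ) : Measurable fun w : Hist S A H k =>
    (episodeLaw M (νf k) (νg k) (L.policy k w)).map fun e =>
      (Fin.snoc w e : Hist S A H (k + 1)) := by
  refine Measure.measurable_of_measurable_coe _ fun s hs => ?_
  have hind : Measurable (s.indicator (1 : Hist S A H (k + 1) → ℝ≥0∞)) :=
    measurable_one.indicator hs
  have heq : ∀ w : Hist S A H k, (episodeLaw M (νf k) (νg k) (L.policy k w)).map
      (fun e => (Fin.snoc w e : Hist S A H (k + 1))) s
      = ∑ τ : Traj S A H, ENNReal.ofReal (trajProb M.init (L.policy k w) M.trans τ)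
        * ∫⁻ z, s.indicator 1 (Fin.snoc w (observe M (τ, z)) : Hist S A H (k + 1))
          ∂((Measure.pi (νf k)).prod (Measure.pi (νg k))) := fun w => by
    rw [← lintegral_indicator_one hs, lintegral_map hind (measurable_snoc_left w)]
    exact lintegral_episodeLaw M (νf k) (νg k) _ (hind.comp (measurable_snoc_left w))
  simp_rw [heq]
  refine Finset.measurable_sum _ fun τ _ =>
    (measurable_trajProb_policy M L k τ).ennreal_ofReal.mul ?_
  refine Measurable.lintegral_prod_right' (f := fun x : Hist S A H k × _ =>
    s.indicator 1 (Fin.snoc x.1 (observe M (τ, x.2)) : Hist S A H (k + 1))) ?_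
  exact hind.comp ((measurable_snoc k).comp (measurable_fst.prodMk
    ((measurable_observe M).comp (measurable_const.prodMk measurable_snd))))

lemma lintegral_runLaw_succ (k : ℕ) {F : Hist S A H (k + 1) → ℝ≥0∞} (hF : Measurable F) :
    ∫⁻ w, F w ∂runLaw M νf νg L (k + 1)
      = ∫⁻ w, ∫⁻ e, F (Fin.snoc w e : Hist S A H (k + 1))
          ∂episodeLaw M (νf k) (νg k) (L.policy k w) ∂runLaw M νf νg L k := by
  rw [runLaw, Measure.lintegral_bind (measurable_map_snoc M νf νg L k).aemeasurable
    hF.aemeasurable]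
  refine lintegral_congr fun w => ?_
  rw [lintegral_map hF (measurable_snoc_left w)]

lemma runLaw_univ (k : ℕ) : runLaw M νf νg L k Set.univ = 1 := by
  induction k with
  | zero => simp [runLaw]
  | succ k ih =>
    rw [← lintegral_one, lintegral_runLaw_succ M νf νg L k measurable_const]
    simp_rw [lintegral_episodeLaw_one M (νf k) (νg k) (L.policy_isPolicy k _)]
    rw [lintegral_one, ih]

instance (k : ℕ) : IsProbabilityMeasure (runLaw M νf νg L k) := ⟨runLaw_univ M νf νg L k⟩

/-- The product of the factors `G` along the recorded episodes. -/
noncomputable def weight (G : (k : ℕ) → Hist S A H k → Episode S A H → ℝ≥0∞) : (k : ℕ) → Hist S A H k → ℝ≥0∞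
  | 0, _ => 1
  | k + 1, w => weight G k (Fin.init w) * G k (Fin.init w) (w (Fin.last k))

lemma measurable_weight {G : (k : ℕ) → Hist S A H k → Episode S A H → ℝ≥0∞}
    (hG : ∀ k, Measurable fun x : Hist S A H k × Episode S A H => G k x.1 x.2) (k : ℕ) :
    Measurable (weight G k) := by
  induction k with
  | zero => exact measurable_const
  | succ k ih =>
    have hinit : Measurable fun w : Hist S A H (k + 1) => (Fin.init w : Hist S A H k) :=
      measurable_pi_lambda _ fun i => measurable_pi_apply i.castSucc
    exact (ih.comp hinit).mul ((hG k).comp (hinit.prodMk (measurable_pi_apply (Fin.last k))))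

/-- A product of factors with conditional means at most one has mean at most one. -/
lemma lintegral_weight_le_one {G : (k : ℕ) → Hist S A H k → Episode S A H → ℝ≥0∞}
    (hG : ∀ k, Measurable fun x : Hist S A H k × Episode S A H => G k x.1 x.2)
    (hG1 : ∀ k w, ∫⁻ e, G k w e ∂episodeLaw M (νf k) (νg k) (L.policy k w) ≤ 1) (k : ℕ) :
    ∫⁻ w, weight G k w ∂runLaw M νf νg L k ≤ 1 := by
  induction k with
  | zero => simp [runLaw, weight]
  | succ k ih =>
    rw [lintegral_runLaw_succ M νf νg L k (measurable_weight hG _)]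
    refine le_trans (lintegral_mono fun w => ?_) ih
    simp only [weight, Fin.init_snoc, Fin.snoc_last]
    have hGw : Measurable (G k w) := (hG k).comp measurable_prodMk_left
    rw [lintegral_const_mul _ hGw]
    exact mul_le_of_le_one_right zero_le (hG1 k w)

end RunLaw

/-! ### Tail bounds at the `n`-th visit. -/

section Tail

open scoped ENNReal

variable {S A : Type*} [Fintype S] [Fintype A] [DecidableEq S] [DecidableEq A] {H : ℕ}

lemma visit_le_one (e : Episode S A H) (s : S) (a : A) (h : Fin H) : visit e s a h ≤ 1 := by
  unfold visit; split_ifs <;> simp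

lemma countN_succ {k : ℕ} (w : Hist S A H (k + 1)) (s : S) (a : A) (h : Fin H) :
    countN w s a h = countN (Fin.init w : Hist S A H k) s a h + visit (w (Fin.last k)) s a h :=
  Fin.sum_univ_castSucc _

/-- The factor `φ` of an episode that is one of the first `n` visits to `(s, a, h)`. -/
noncomputable def visitFactor (s : S) (a : A) (h : Fin H) (n : ℕ) (φ : Episode S A H → ℝ≥0∞) :
    (k : ℕ) → Hist S A H k → Episode S A H → ℝ≥0∞ :=
  fun _ w e => if visit e s a h = 1 ∧ countN w s a h < n then φ e else 1

/-- While at most `n` visits have occurred, no visit has been cut off by the truncation. -/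
lemma weight_visitFactor_of_countN_le (s : S) (a : A) (h : Fin H) (n : ℕ)
    (x : Episode S A H → ℝ) {k : ℕ} (w : Hist S A H k) (hw : countN w s a h ≤ n) :
    weight (visitFactor s a h n fun e => ENNReal.ofReal (Real.exp (x e))) k w
      = ENNReal.ofReal (Real.exp (∑ j, visit (w j) s a h * x (w j))) := by
  induction k with
  | zero => simp [weight]
  | succ k ih =>
    rw [countN_succ] at hw
    rw [weight, ih _ (by omega), Fin.sum_univ_castSucc, Real.exp_add,
      ENNReal.ofReal_mul (Real.exp_nonneg _)]
    congr 1
    rcases Nat.le_one_iff_eq_zero_or_eq_one.1 (visit_le_one (w (Fin.last k)) s a h) with h0 | h1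
    · simp [visitFactor, h0]
    · rw [visitFactor, if_pos ⟨h1, by omega⟩, h1]
      simp

lemma countN_take_mono {K : ℕ} (ω : Hist S A H K) (s : S) (a : A) (h : Fin H) {k m : ℕ}
    (hkm : k ≤ m) (hm : m ≤ K) :
    countN (Fin.take k (hkm.trans hm) ω) s a h ≤ countN (Fin.take m hm ω) s a h := by
  induction m, hkm using Nat.le_induction with
  | base => exact le_rfl
  | succ m hkm ih =>
    rw [countN_succ]
    exact (ih (by omega)).trans (Nat.le_add_right _ _)

/-- After `n` visits all further factors are one. The terminal weight thus remembers the sum at the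
`n`-th visit, so no union over episodes or stopping theorem is needed. -/
lemma weight_visitFactor_take {K : ℕ} (ω : Hist S A H K) (s : S) (a : A) (h : Fin H) {n : ℕ}
    (φ : Episode S A H → ℝ≥0∞) {k m : ℕ} (hkm : k ≤ m) (hm : m ≤ K)
    (hn : n ≤ countN (Fin.take k (hkm.trans hm) ω) s a h) :
    weight (visitFactor s a h n φ) m (Fin.take m hm ω)
      = weight (visitFactor s a h n φ) k (Fin.take k (hkm.trans hm) ω) := by
  induction m, hkm using Nat.le_induction with
  | base => rfl
  | succ m hkm ih =>
    have h1 : n ≤ countN (Fin.take m (by omega) ω) s a h :=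
      hn.trans (countN_take_mono ω s a h hkm (by omega))
    have h2 : (Fin.init (Fin.take (m + 1) hm ω) : Hist S A H m) = Fin.take m (by omega) ω := rfl
    rw [weight, h2, ih (by omega) hn, visitFactor, if_neg (by omega), mul_one]

lemma countN_take_lt {K : ℕ} (ω : Hist S A H K) (k : Fin K) (s : S) (a : A) (h : Fin H) :
    countN (Fin.take k k.isLt.le ω) s a h < K := by
  refine lt_of_le_of_lt ?_ k.isLt
  calc countN (Fin.take k k.isLt.le ω) s a h ≤ ∑ _j : Fin k, 1 :=
        Finset.sum_le_sum fun j _ => visit_le_one _ _ _ _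
    _ = k := by simp

variable [MeasurableSpace S] [DiscreteMeasurableSpace S] [MeasurableSpace A]
  [DiscreteMeasurableSpace A]

lemma measurable_visit (s : S) (a : A) (h : Fin H) :
    Measurable fun e : Episode S A H => visit e s a h :=
  (Measurable.of_discrete (f := fun τ : Traj S A H =>
    if τ.1 h.castSucc = s ∧ τ.2 h = a then 1 else 0)).comp measurable_fst

lemma measurable_countN (k : ℕ) (s : S) (a : A) (h : Fin H) :
    Measurable fun w : Hist S A H k => countN w s a h :=
  Finset.measurable_sum _ fun j _ => (measurable_visit s a h).comp (measurable_pi_apply j)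

lemma measurable_visitFactor (s : S) (a : A) (h : Fin H) (n : ℕ) {φ : Episode S A H → ℝ≥0∞}
    (hφ : Measurable φ) (k : ℕ) :
    Measurable fun x : Hist S A H k × Episode S A H => visitFactor s a h n φ k x.1 x.2 := by
  refine Measurable.ite ?_ (hφ.comp measurable_snd) measurable_const
  exact (((measurable_visit s a h).comp measurable_snd) (measurableSet_singleton 1)).inter
    (((measurable_countN k s a h).comp measurable_fst) measurableSet_Iio)

/-- The runs in which, at the time of the `n`-th visit to `(s, a, h)`, the sum of `x` over the
visits is at least `c`. -/
def tailSet (K : ℕ) (s : S) (a : A) (h : Fin H) (n : ℕ) (x : Episode S A H → ℝ) (c : ℝ) :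
    Set (Hist S A H K) :=
  {ω | ∃ k, ∃ hk : k ≤ K, countN (Fin.take k hk ω) s a h = n ∧
    c ≤ ∑ j, visit (Fin.take k hk ω j) s a h * x (Fin.take k hk ω j)}

/-- An exponential tail bound for sums over the first `n` visits to `(s, a, h)`, at whichever
episode the number of visits is `n`. -/
lemma runLaw_sum_visit_ge_le (M : CMDP S A H) (νf νg : ℕ → S × A × Fin H → Measure ℝ)
    [∀ k i, IsProbabilityMeasure (νf k i)] [∀ k i, IsProbabilityMeasure (νg k i)]
    (L : Learner S A H) (s : S) (a : A) (h : Fin H) (n : ℕ) {x : Episode S A H → ℝ}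
    (hx : Measurable x)
    (hx1 : ∀ k π, IsPolicy π → ∫⁻ e, (if visit e s a h = 1 then ENNReal.ofReal (Real.exp (x e))
      else 1) ∂episodeLaw M (νf k) (νg k) π ≤ 1) (K : ℕ) (c : ℝ) :
    runLaw M νf νg L K (tailSet K s a h n x c) ≤ ENNReal.ofReal (Real.exp (-c)) := by
  set φ : Episode S A H → ℝ≥0∞ := fun e => ENNReal.ofReal (Real.exp (x e)) with hφ
  have hφm : Measurable φ := hx.exp.ennreal_ofReal
  have hGm := measurable_visitFactor s a h n hφm
  have hG1 : ∀ k w, ∫⁻ e, visitFactor s a h n φ k w e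
      ∂episodeLaw M (νf k) (νg k) (L.policy k w) ≤ 1 := by
    intro k w
    by_cases hw : countN w s a h < n
    · simpa [visitFactor, hw] using hx1 k _ (L.policy_isPolicy k w)
    · simpa [visitFactor, hw] using
        (lintegral_episodeLaw_one M (νf k) (νg k) (L.policy_isPolicy k w)).le
  have hle := lintegral_weight_le_one M νf νg L hGm hG1 K
  have hsub : tailSet K s a h n x c
      ⊆ {ω | ENNReal.ofReal (Real.exp c) ≤ weight (visitFactor s a h n φ) K ω} := by
    rintro ω ⟨k, hk, hn, hc⟩
    have h1 := weight_visitFactor_take ω s a h φ hk le_rfl hn.ge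
    have h2 := weight_visitFactor_of_countN_le s a h n x (Fin.take k hk ω) hn.le
    have h3 : Fin.take K le_rfl ω = ω := rfl
    rw [h3, h2] at h1
    refine le_of_le_of_eq ?_ h1.symm
    exact ENNReal.ofReal_le_ofReal (Real.exp_le_exp.2 hc)
  refine (measure_mono hsub).trans ((meas_ge_le_lintegral_div
    (measurable_weight hGm K).aemeasurable
    (ENNReal.ofReal_pos.2 (Real.exp_pos c)).ne' ENNReal.ofReal_ne_top).trans ?_)
  rw [Real.exp_neg, ENNReal.ofReal_inv_of_pos (Real.exp_pos c), ENNReal.div_eq_inv_mul]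
  exact mul_le_of_le_one_right zero_le hle

end Tail

/-! ### Chernoff tilts for empirical Bernstein bounds. -/

section Scalar

lemma one_sub_mul_exp_le {z : ℝ} (h0 : 0 ≤ z) (h1 : z ≤ 1) :
    (1 - z) * Real.exp z ≤ 1 - z ^ 2 / 2 := by
  have h := Real.exp_bound' h0 h1 (n := 3) (by norm_num)
  norm_num [Finset.sum_range_succ, Nat.factorial] at h
  have h2 : (1 - z) * Real.exp z ≤ (1 - z) * (1 + z + z ^ 2 / 2 + z ^ 3 * 4 / 18) :=
    mul_le_mul_of_nonneg_left h (by linarith)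
  have h3 : 0 ≤ z ^ 3 := by positivity
  have h4 : 0 ≤ z ^ 4 := by positivity
  nlinarith

lemma exp_neg_le_quadratic {z : ℝ} (h0 : 0 ≤ z) : Real.exp (-z) ≤ 1 - z + z ^ 2 / 2 := by
  have h := Real.quadratic_le_exp_of_nonneg h0
  have hpos : 0 < 1 + z + z ^ 2 / 2 := by positivity
  rw [Real.exp_neg]
  calc (Real.exp z)⁻¹ ≤ (1 + z + z ^ 2 / 2)⁻¹ := inv_anti₀ hpos h
    _ ≤ 1 - z + z ^ 2 / 2 := by
        rw [inv_le_iff_one_le_mul₀ hpos]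
        nlinarith [sq_nonneg (z ^ 2)]

/-- The tilt that bounds the upper deviations of a binomial frequency `m / n` from `p`. -/
lemma exists_tilt_upper {n : ℕ} (hn : 0 < n) {p L : ℝ} (hp : 0 ≤ p) (hL : 0 ≤ L) :
    ∃ t : ℝ, ∀ m : ℕ, p + 2 * Real.sqrt ((m : ℝ) / n * L / n) < (m : ℝ) / n →
      2 * L ≤ t * m - n * (p * (Real.exp t - 1)) := by
  classical
  by_cases hex : ∃ m : ℕ, p + 2 * Real.sqrt ((m : ℝ) / n * L / n) < (m : ℝ) / n
  swap
  · exact ⟨0, fun m hm => absurd ⟨m, hm⟩ hex⟩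
  -- The tilt is tuned to the least bad count `m₀`. Being nonnegative, it serves every larger count
  -- as well, since the exponent increases with `m`.
  have hspec := Nat.find_spec hex
  set m₀ := Nat.find hex with hm₀
  have hn' : (0 : ℝ) < n := by exact_mod_cast hn
  set x : ℝ := (m₀ : ℝ) / n with hx
  have hsq := Real.sq_sqrt (show 0 ≤ x * L / n by positivity)
  have hs0 := Real.sqrt_nonneg (x * L / n)
  set q := Real.sqrt (x * L / n)
  have hpx : p < x := by linarith
  have hx0 : 0 < x := hp.trans_lt hpx
  -- A rational substitute for the optimal tilt `log (x / p)`; it gives exponent at least `n x t² /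
  -- 2`, where `(x t)² = (x - p)² ≥ 4 x L / n`.
  set t := 1 - p / x with ht
  have hpt : p = x * (1 - t) := by rw [ht]; field_simp; ring
  have ht0 : 0 ≤ t := by
    rw [ht, sub_nonneg, div_le_one hx0]; exact hpx.le
  have ht1 : t ≤ 1 := by
    have : 0 ≤ p / x := by positivity
    linarith
  have hbase : 2 * L ≤ t * m₀ - n * (p * (Real.exp t - 1)) := by
    have h1 := one_sub_mul_exp_le ht0 ht1
    have hm : (m₀ : ℝ) = n * x := by rw [hx]; field_simp
    have h2 : t * (m₀ : ℝ) - n * (p * (Real.exp t - 1))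
        = n * (x * (1 - (1 - t) * Real.exp t)) := by
      rw [hm, hpt]; ring
    have h3 : (2 * q) ^ 2 ≤ (x * t) ^ 2 := by
      have : x * t = x - p := by rw [hpt]; ring
      rw [this]
      exact pow_le_pow_left₀ (by positivity) (by linarith) 2
    have h4 : 4 * (x * L) ≤ n * (x * t) ^ 2 := by
      have e : (2 * q) ^ 2 * n = 4 * (x * L) := by
        rw [mul_pow, hsq]; field_simp; ring
      nlinarith
    have h5 : 4 * L ≤ n * (x * t ^ 2) := by
      have : x * (4 * L) ≤ x * (n * (x * t ^ 2)) := by nlinarith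
      exact le_of_mul_le_mul_left this hx0
    have h6 : n * (x * (t ^ 2 / 2)) ≤ n * (x * (1 - (1 - t) * Real.exp t)) := by
      gcongr
      linarith
    rw [h2]
    linarith
  refine ⟨t, fun m hm => hbase.trans ?_⟩
  have : (m₀ : ℝ) ≤ m := by exact_mod_cast Nat.find_min' hex hm
  have := mul_le_mul_of_nonneg_left this ht0
  linarith

/-- The tilt that bounds the lower deviations of a binomial frequency `m / n` from `p`. -/
lemma exists_tilt_lower {n : ℕ} (hn : 0 < n) {p L : ℝ} (hp1 : p ≤ 1) (hL : 0 ≤ L) :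
    ∃ t : ℝ, ∀ m : ℕ, (m : ℝ) / n + 2 * Real.sqrt ((m : ℝ) / n * L / n) + 4 * L / n < p →
      2 * L ≤ t * m - n * (p * (Real.exp t - 1)) := by
  classical
  have hn' : (0 : ℝ) < n := by exact_mod_cast hn
  set Bad : ℕ → Prop := fun m =>
    (m : ℝ) / n + 2 * Real.sqrt ((m : ℝ) / n * L / n) + 4 * L / n < p with hBad
  have hle : ∀ m, Bad m → m ≤ n := fun m hm => by
    have h1 := Real.sqrt_nonneg ((m : ℝ) / n * L / n)
    have h2 : 0 ≤ 4 * L / n := by positivity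
    have h3 : (m : ℝ) / n < 1 := by
      simp only [hBad] at hm
      linarith
    rw [div_lt_one hn'] at h3
    exact_mod_cast h3.le
  by_cases hex : ∃ m, Bad m
  swap
  · exact ⟨0, fun m hm => absurd ⟨m, hm⟩ hex⟩
  obtain ⟨m₁, hm₁⟩ := hex
  -- For lower deviations the tilt is nonpositive, so the greatest bad count is the extreme one; bad
  -- counts are bounded by `n` because `p ≤ 1`.
  have hspec : Bad (Nat.findGreatest Bad n) := Nat.findGreatest_spec (hle _ hm₁) hm₁
  set m₀ := Nat.findGreatest Bad n with hm₀
  simp only [hBad] at hspec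
  set x : ℝ := (m₀ : ℝ) / n with hx
  have hx0 : 0 ≤ x := by positivity
  have hsq := Real.sq_sqrt (show 0 ≤ x * L / n by positivity)
  have hs0 := Real.sqrt_nonneg (x * L / n)
  set q := Real.sqrt (x * L / n)
  have hLn : 0 ≤ 4 * L / n := by positivity
  have hpx : x < p := by linarith
  have hp0 : 0 < p := hx0.trans_lt hpx
  set t := 1 - x / p with ht
  have hxt : x = p * (1 - t) := by rw [ht]; field_simp; ring
  have ht0 : 0 ≤ t := by
    rw [ht, sub_nonneg, div_le_one hp0]; exact hpx.le
  have hbase : 2 * L ≤ -t * m₀ - n * (p * (Real.exp (-t) - 1)) := by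
    have h1 := exp_neg_le_quadratic ht0
    have hm : (m₀ : ℝ) = n * x := by rw [hx]; field_simp
    have h2 : n * (p * (t ^ 2 / 2)) ≤ -t * (m₀ : ℝ) - n * (p * (Real.exp (-t) - 1)) := by
      have : -t * (m₀ : ℝ) - n * (p * (Real.exp (-t) - 1)) - n * (p * (t ^ 2 / 2))
          = n * p * (1 - t + t ^ 2 / 2 - Real.exp (-t)) := by
        rw [hm, hxt]; ring
      have h0 : 0 ≤ n * p * (1 - t + t ^ 2 / 2 - Real.exp (-t)) :=
        mul_nonneg (by positivity) (by linarith)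
      linarith
    have hd : p - x = p * t := by rw [hxt]; ring
    -- With `c = 4L/n` and `d = p - x > 2q + c`, one gets `d (d - c) ≥ 4 q² = c x`, hence `d² ≥ c (x
    -- + d) = c p`. The summand `4L/n` is there to trade `x` for `p`.
    have h3 : 4 * L / n * p ≤ (p * t) ^ 2 := by
      rw [← hd]
      have e : 4 * L / n * x = (2 * q) ^ 2 := by rw [mul_pow, hsq]; ring
      have h5 : (2 * q + 4 * L / n) * (2 * q) ≤ (p - x) * (p - x - 4 * L / n) :=
        mul_le_mul (by linarith) (by linarith) (by positivity) (by linarith)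
      have h6 : 0 ≤ 4 * L / n * (2 * q) := by positivity
      nlinarith
    have h4 : p * (4 * L) ≤ p * (n * (p * t ^ 2)) := by
      have : 4 * L / n * p * n ≤ (p * t) ^ 2 * n := mul_le_mul_of_nonneg_right h3 hn'.le
      have e : 4 * L / n * p * n = p * (4 * L) := by field_simp
      nlinarith
    have h5 := le_of_mul_le_mul_left h4 hp0
    linarith
  refine ⟨-t, fun m hm => hbase.trans ?_⟩
  have : (m : ℝ) ≤ m₀ := by exact_mod_cast Nat.le_findGreatest (hle m hm) hm
  have := mul_le_mul_of_nonneg_left this ht0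
  linarith

end Scalar

/-! ### Conditional exponential moments of observed costs and transitions. -/

section Concentration

open scoped ENNReal

variable {S A : Type*} [Fintype S] [Fintype A] [DecidableEq S] [DecidableEq A]
  [MeasurableSpace S] [DiscreteMeasurableSpace S] [MeasurableSpace A]
  [DiscreteMeasurableSpace A] {H : ℕ}

/-- The log-weight of an observed cost at `(s, a, h)`. -/
noncomputable def costStat (M : CMDP S A H) (s : S) (a : A) (h : Fin H) (t : ℝ)
    (e : Episode S A H) : ℝ :=
  t * (e.2.2 h - M.cost s a h) - t ^ 2 / 4

/-- The log-weight of a transition from `(s, a, h)`, relative to the next state `s'`. -/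
noncomputable def transStat (M : CMDP S A H) (s : S) (a : A) (h : Fin H) (s' : S) (t : ℝ)
    (e : Episode S A H) : ℝ :=
  t * (if e.1.1 h.succ = s' then 1 else 0) - M.trans s a h s' * (Real.exp t - 1)

lemma measurable_costStat (M : CMDP S A H) (s : S) (a : A) (h : Fin H) (t : ℝ) :
    Measurable (costStat M s a h t) := by
  unfold costStat
  have : Measurable fun e : Episode S A H => e.2.2 h :=
    (measurable_pi_apply h).comp (measurable_snd.comp measurable_snd)
  exact ((this.sub_const _).const_mul t).sub_const _

lemma measurable_transStat (M : CMDP S A H) (s : S) (a : A) (h : Fin H) (s' : S) (t : ℝ) :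
    Measurable (transStat M s a h s' t) :=
  (Measurable.of_discrete (f := fun τ : Traj S A H =>
    t * (if τ.1 h.succ = s' then 1 else 0) - M.trans s a h s' * (Real.exp t - 1))).comp
      measurable_fst

lemma sum_visit_mul_costStat (M : CMDP S A H) {k : ℕ} (w : Hist S A H k) (s : S) (a : A)
    (h : Fin H) (t : ℝ) :
    ∑ j, (visit (w j) s a h : ℝ) * costStat M s a h t (w j)
      = t * (∑ j, (w j).2.2 h * (visit (w j) s a h : ℝ) - countN w s a h * M.cost s a h)
        - countN w s a h * (t ^ 2 / 4) := by
  simp only [costStat, countN, Nat.cast_sum, Finset.sum_mul, Finset.mul_sum,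
    ← Finset.sum_sub_distrib]
  exact Finset.sum_congr rfl fun j _ => by ring

lemma sum_visit_mul_transStat (M : CMDP S A H) {k : ℕ} (w : Hist S A H k) (s : S) (a : A)
    (h : Fin H) (s' : S) (t : ℝ) :
    ∑ j, (visit (w j) s a h : ℝ) * transStat M s a h s' t (w j)
      = t * countM w s a s' h - countN w s a h * (M.trans s a h s' * (Real.exp t - 1)) := by
  simp only [transStat, countN, countM, Nat.cast_sum, Finset.sum_mul, Finset.mul_sum,
    ← Finset.sum_sub_distrib]
  refine Finset.sum_congr rfl fun j _ => ?_
  split_ifs <;> push_cast <;> ring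

lemma measurable_visit_ite (s : S) (a : A) (h : Fin H) {x : Episode S A H → ℝ}
    (hx : Measurable x) : Measurable fun e : Episode S A H =>
      if visit e s a h = 1 then ENNReal.ofReal (Real.exp (x e)) else 1 :=
  Measurable.ite ((measurable_visit s a h) (measurableSet_singleton 1))
    hx.exp.ennreal_ofReal measurable_const

lemma visit_eq_one_iff (e : Episode S A H) (s : S) (a : A) (h : Fin H) :
    visit e s a h = 1 ↔ e.1.1 h.castSucc = s ∧ e.1.2 h = a := by
  simp [visit]

lemma lintegral_exp_noise_le {ν : Measure ℝ} (hν : IsNoise ν) (t : ℝ) :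
    ∫⁻ y, ENNReal.ofReal (Real.exp (t * y - t ^ 2 / 4)) ∂ν ≤ 1 := by
  obtain ⟨_, -, hsub⟩ := hν
  have h1 := hsub.mgf_le t
  have h2 := hsub.integrable_exp_mul t
  have h3 : ∀ y, Real.exp (t * y - t ^ 2 / 4) = Real.exp (t * y) * Real.exp (-(t ^ 2 / 4)) :=
    fun y => by rw [← Real.exp_add]; ring_nf
  simp_rw [h3]
  rw [← ofReal_integral_eq_lintegral_ofReal (h2.mul_const _)
    (Filter.Eventually.of_forall fun y => by positivity), integral_mul_const,
    ENNReal.ofReal_le_one]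
  calc (∫ y, Real.exp (t * y) ∂ν) * Real.exp (-(t ^ 2 / 4))
      ≤ Real.exp (t ^ 2 / 4) * Real.exp (-(t ^ 2 / 4)) := by
        refine mul_le_mul_of_nonneg_right (h1.trans (le_of_eq ?_)) (Real.exp_nonneg _)
        congr 1
        push_cast
        ring
    _ = 1 := by rw [← Real.exp_add]; simp

/-- The noise is independent of the trajectory, so the bound holds for each trajectory separately
and only the coordinate `(s, a, h)` of the cost noise matters. -/
lemma lintegral_costStat_le_one (M : CMDP S A H) {νf νg : S × A × Fin H → Measure ℝ}
    (hνf : ∀ i, IsNoise (νf i)) (hνg : ∀ i, IsNoise (νg i)) (s : S) (a : A) (h : Fin H) (t : ℝ)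
    {π : Pol S A H} (hπ : IsPolicy π) :
    ∫⁻ e, (if visit e s a h = 1 then ENNReal.ofReal (Real.exp (costStat M s a h t e)) else 1)
      ∂episodeLaw M νf νg π ≤ 1 := by
  have := fun i => (hνf i).1
  have := fun i => (hνg i).1
  rw [lintegral_episodeLaw M νf νg π (measurable_visit_ite s a h (measurable_costStat M s a h t))]
  have hone := lintegral_episodeLaw_one M νf νg hπ
  rw [lintegral_episodeLaw M νf νg π measurable_const] at hone
  refine le_trans (Finset.sum_le_sum fun τ _ => mul_le_mul_right ?_ _) hone.le
  rw [lintegral_one, measure_univ]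
  by_cases hv : τ.1 h.castSucc = s ∧ τ.2 h = a
  · have hpre : MeasurePreserving (fun z : (S × A × Fin H → ℝ) × (S × A × Fin H → ℝ) =>
        z.2 (s, a, h)) ((Measure.pi νf).prod (Measure.pi νg)) (νg (s, a, h)) :=
      (measurePreserving_eval νg (s, a, h)).comp measurePreserving_snd
    have heq : ∀ z, (if visit (observe M (τ, z)) s a h = 1 then
        ENNReal.ofReal (Real.exp (costStat M s a h t (observe M (τ, z)))) else 1)
        = ENNReal.ofReal (Real.exp (t * z.2 (s, a, h) - t ^ 2 / 4)) := fun z => by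
      rw [if_pos ((visit_eq_one_iff _ s a h).2 hv)]
      obtain ⟨rfl, rfl⟩ := hv
      simp [costStat, observe]
    refine (lintegral_congr heq).trans_le ?_
    have hm : Measurable fun y : ℝ => ENNReal.ofReal (Real.exp (t * y - t ^ 2 / 4)) := by fun_prop
    rw [hpre.lintegral_comp hm]
    exact lintegral_exp_noise_le (hνg _) t
  · have heq : ∀ z, (if visit (observe M (τ, z)) s a h = 1 then
        ENNReal.ofReal (Real.exp (costStat M s a h t (observe M (τ, z)))) else 1) = 1 := fun z =>
      if_neg fun h1 => hv ((visit_eq_one_iff _ s a h).1 h1)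
    refine (lintegral_congr heq).trans_le ?_
    simp

/-- Given a visit, the indicator of `s'` is Bernoulli with parameter `q`, and `1 + q (e^t - 1) ≤ exp
(q (e^t - 1))`: the Poisson bound on its moment generating function. -/
lemma lintegral_transStat_le_one (M : CMDP S A H) (νf νg : S × A × Fin H → Measure ℝ)
    [∀ i, IsProbabilityMeasure (νf i)] [∀ i, IsProbabilityMeasure (νg i)] (s : S) (a : A)
    (h : Fin H) (s' : S) (t : ℝ) {π : Pol S A H} (hπ : IsPolicy π) :
    ∫⁻ e, (if visit e s a h = 1 then ENNReal.ofReal (Real.exp (transStat M s a h s' t e)) else 1)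
      ∂episodeLaw M νf νg π ≤ 1 := by
  have hP := M.trans_isKernel
  set F : S → A → S → ℝ := fun s₀ a₀ s₁ => if s₀ = s ∧ a₀ = a then
    Real.exp (t * (if s₁ = s' then 1 else 0) - M.trans s a h s' * (Real.exp t - 1)) else 1 with hF
  have hF0 : ∀ s₀ a₀ s₁, 0 ≤ F s₀ a₀ s₁ := fun s₀ a₀ s₁ => by
    simp only [hF]; split_ifs <;> positivity
  rw [lintegral_episodeLaw M νf νg π
    (measurable_visit_ite s a h (measurable_transStat M s a h s' t))]
  have heq : ∀ τ z, (if visit (observe M (τ, z)) s a h = 1 then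
      ENNReal.ofReal (Real.exp (transStat M s a h s' t (observe M (τ, z)))) else 1)
      = ENNReal.ofReal (F (τ.1 h.castSucc) (τ.2 h) (τ.1 h.succ)) := fun τ z => by
    simp only [hF]
    by_cases hv : τ.1 h.castSucc = s ∧ τ.2 h = a
    · rw [if_pos ((visit_eq_one_iff _ s a h).2 hv), if_pos hv]
      rfl
    · rw [if_neg fun h1 => hv ((visit_eq_one_iff _ s a h).1 h1), if_neg hv, ENNReal.ofReal_one]
  simp_rw [heq, lintegral_const, measure_univ, mul_one]
  have hT := trajProb_nonneg M.init_nonneg hπ hP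
  rw [Finset.sum_congr rfl fun τ _ => (ENNReal.ofReal_mul (hT τ)).symm,
    ← ENNReal.ofReal_sum_of_nonneg fun τ _ => mul_nonneg (hT τ) (hF0 _ _ _),
    ENNReal.ofReal_le_one, sum_trajProb_mul_step_eq_stepMean M.init hπ hP h F]
  have hpt : ∀ s₀ a₀, ∑ s₁, M.trans s₀ a₀ h s₁ * F s₀ a₀ s₁ ≤ 1 := fun s₀ a₀ => by
    by_cases hv : s₀ = s ∧ a₀ = a
    · obtain ⟨rfl, rfl⟩ := hv
      set q := M.trans s₀ a₀ h s' with hq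
      have e1 : ∀ s₁, M.trans s₀ a₀ h s₁ * F s₀ a₀ s₁
          = Real.exp (-(q * (Real.exp t - 1)))
            * (M.trans s₀ a₀ h s₁ + if s₁ = s' then q * (Real.exp t - 1) else 0) := fun s₁ => by
        simp only [hF, and_self, if_true, sub_eq_add_neg, Real.exp_add]
        split_ifs with h1
        · rw [h1, ← hq, mul_one]; ring
        · simp; ring
      simp_rw [e1, ← Finset.mul_sum, Finset.sum_add_distrib, (hP s₀ a₀ h).2,
        Finset.sum_ite_eq', Finset.mem_univ, if_true]
      have h1 := Real.add_one_le_exp (q * (Real.exp t - 1))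
      calc _ ≤ Real.exp (-(q * (Real.exp t - 1))) * Real.exp (q * (Real.exp t - 1)) :=
            mul_le_mul_of_nonneg_left (by linarith) (Real.exp_nonneg _)
        _ = 1 := by rw [← Real.exp_add]; simp
    · simp only [hF, if_neg hv, mul_one, (hP s₀ a₀ h).2, le_refl]
  calc stepMean M.init π M.trans h (fun s₀ a₀ => ∑ s₁, M.trans s₀ a₀ h s₁ * F s₀ a₀ s₁)
      ≤ ∑ τ, trajProb M.init π M.trans τ * 1 := Finset.sum_le_sum fun τ _ =>
        mul_le_mul_of_nonneg_left (hpt _ _) (hT τ)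
    _ = 1 := by simp [sum_trajProb M.init_sum hπ hP]

end Concentration

/-! ### From tail events to confidence radii. -/

section Deviation

variable {S A : Type*} [Fintype S] [Fintype A] [DecidableEq S] [DecidableEq A] {H k : ℕ}

lemma one_le_logTerm {K : ℕ} {δ : ℝ} (hδ0 : 0 < δ) (hδ : 14 * δ < 1) (hH : 1 ≤ H)
    (hS : 1 ≤ Fintype.card S) (hA : 1 ≤ Fintype.card A) (hK : 1 ≤ K) :
    1 ≤ logTerm S A H K δ := by
  have hn : (1 : ℝ) ≤ (H : ℝ) * Fintype.card S * Fintype.card A * K := by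
    exact_mod_cast Nat.mul_pos (Nat.mul_pos (Nat.mul_pos hH hS) hA) hK
  rw [logTerm, Real.le_log_iff_exp_le (by positivity), le_div_iff₀ hδ0]
  have := Real.exp_one_lt_d9
  nlinarith

lemma exp_neg_logTerm {K : ℕ} {δ : ℝ} (hδ0 : 0 < δ) (hH : 1 ≤ H)
    (hS : 1 ≤ Fintype.card S) (hA : 1 ≤ Fintype.card A) (hK : 1 ≤ K) :
    Real.exp (-logTerm S A H K δ)
      = δ / ((H : ℝ) * Fintype.card S * Fintype.card A * K) := by
  have hn : (1 : ℝ) ≤ (H : ℝ) * Fintype.card S * Fintype.card A * K := by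
    exact_mod_cast Nat.mul_pos (Nat.mul_pos (Nat.mul_pos hH hS) hA) hK
  rw [logTerm, Real.exp_neg, Real.exp_log (by positivity), inv_div]

lemma countM_le_countN (w : Hist S A H k) (s : S) (a : A) (h : Fin H) (s' : S) :
    countM w s a s' h ≤ countN w s a h :=
  Finset.sum_le_sum fun j _ => by split_ifs <;> simp

/-- Without visits the estimate is `0`, and `L ≥ 1` makes the radius at least `1`. -/
lemma abs_empCost_sub_le_of_countN_eq_zero {g : Fn S A H}
    (hg : ∀ s a h, g s a h ∈ Set.Icc (0 : ℝ) 1) {K : ℕ} {δ : ℝ} (hL : 1 ≤ logTerm S A H K δ)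
    (w : Hist S A H k) {s : S} {a : A} {h : Fin H} (hN : countN w s a h = 0) :
    |empCost w s a h - g s a h| ≤ radiusFn K δ w s a h := by
  have hv : ∀ j, visit (w j) s a h = 0 := fun j =>
    (Finset.sum_eq_zero_iff.1 hN) j (Finset.mem_univ j)
  have h1 : empCost w s a h = 0 := by simp [empCost, hv]
  have h2 : 1 ≤ radiusFn K δ w s a h := by
    simp only [radiusFn, hN, Nat.cast_zero]
    rw [Real.one_le_sqrt]
    simpa using hL
  rw [h1, zero_sub, abs_neg, abs_of_nonneg (hg s a h).1]
  exact (hg s a h).2.trans h2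

/-- The tilts `± 2 √(L/n)` are the Chernoff optimum for deviation `n √(L/n)` with variance proxy
`1/2`. -/
lemma abs_empCost_sub_le {g : Fn S A H} {K : ℕ} {δ : ℝ} (hL : 1 ≤ logTerm S A H K δ)
    (w : Hist S A H k) {s : S} {a : A} {h : Fin H} (hN : 0 < countN w s a h)
    (hdev : ∀ t : ℝ, |t| = 2 * Real.sqrt (logTerm S A H K δ / countN w s a h) →
      t * (∑ j, (w j).2.2 h * (visit (w j) s a h : ℝ) - countN w s a h * g s a h)
        - countN w s a h * (t ^ 2 / 4) < logTerm S A H K δ) :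
    |empCost w s a h - g s a h| ≤ radiusFn K δ w s a h := by
  have hn1 : (1 : ℝ) ≤ countN w s a h := by exact_mod_cast hN
  simp only [empCost, radiusFn]
  rw [max_eq_right hn1]
  set n : ℝ := (countN w s a h : ℝ)
  set L := logTerm S A H K δ
  have hn0 : 0 < n := by linarith
  have hv0 : 0 < Real.sqrt (L / n) := Real.sqrt_pos.2 (by positivity)
  have hv2 : n * Real.sqrt (L / n) ^ 2 = L := by
    rw [Real.sq_sqrt (by positivity)]; field_simp
  set v := Real.sqrt (L / n)
  set Y := ∑ j, (w j).2.2 h * (visit (w j) s a h : ℝ)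
  have h1 := hdev (2 * v) (abs_of_pos (by positivity))
  have h2 := hdev (-(2 * v)) (by rw [abs_neg]; exact abs_of_pos (by positivity))
  have h3 : v * (Y - n * g s a h) ≤ v * (n * v) := by nlinarith
  have h4 : v * (-(n * v)) ≤ v * (Y - n * g s a h) := by nlinarith
  have e : Y / n - g s a h = (Y - n * g s a h) / n := by field_simp
  rw [e, abs_div, abs_of_pos hn0, div_le_iff₀ hn0, abs_le]
  have h5 := le_of_mul_le_mul_left h3 hv0
  have h6 := le_of_mul_le_mul_left h4 hv0
  constructor <;> linarith

lemma abs_sub_empKer_le_of_countN_eq_zero {P : Ker S A H} (hP : IsKernel P) {K : ℕ} {δ : ℝ}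
    (hL : 1 ≤ logTerm S A H K δ) (w : Hist S A H k) {s : S} {a : A} {h : Fin H}
    (hN : countN w s a h = 0) (s' : S) :
    |P s a h s' - empKer w s a h s'| ≤ radiusKer K δ w s a h s' := by
  have hM : countM w s a s' h = 0 := Nat.le_zero.1 (hN ▸ countM_le_countN w s a h s')
  have h1 : empKer w s a h s' = 0 := by simp [empKer, hM]
  have h2 : P s a h s' ≤ 1 := by
    rw [← (hP s a h).2]
    exact Finset.single_le_sum (fun i _ => (hP s a h).1 i) (Finset.mem_univ s')
  have hD : den w s a h = 1 := by simp [den, hN]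
  rw [h1, sub_zero, abs_of_nonneg ((hP s a h).1 s'), radiusKer, hD, h1]
  simp
  linarith

/-- There is room to spare: `D ≤ N` and `4 ≤ 14/3`. -/
lemma abs_sub_empKer_le {q : ℝ} {K : ℕ} {δ : ℝ} (hL : 1 ≤ logTerm S A H K δ)
    (w : Hist S A H k) {s : S} {a : A} {h : Fin H} (hN : 0 < countN w s a h) {s' : S}
    (hup : (countM w s a s' h : ℝ) / countN w s a h ≤ q + 2 * Real.sqrt
      ((countM w s a s' h : ℝ) / countN w s a h * logTerm S A H K δ / countN w s a h))
    (hlo : q ≤ (countM w s a s' h : ℝ) / countN w s a h + 2 * Real.sqrt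
      ((countM w s a s' h : ℝ) / countN w s a h * logTerm S A H K δ / countN w s a h)
      + 4 * logTerm S A H K δ / countN w s a h) :
    |q - empKer w s a h s'| ≤ radiusKer K δ w s a h s' := by
  have hn1 : (1 : ℝ) ≤ countN w s a h := by exact_mod_cast hN
  have hDn : den w s a h ≤ countN w s a h := max_le hn1 (by linarith)
  have hD1 := one_le_den w s a h
  have he : empKer w s a h s' = (countM w s a s' h : ℝ) / countN w s a h := by
    rw [empKer, max_eq_right hn1]
  have hx0 := empKer_nonneg w s a h s'
  rw [← he] at hup hlo
  simp only [radiusKer]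
  set D := den w s a h
  set x := empKer w s a h s'
  set L := logTerm S A H K δ
  have h1 : Real.sqrt (x * L / countN w s a h) ≤ Real.sqrt (x * L / D) :=
    Real.sqrt_le_sqrt (div_le_div_of_nonneg_left (by positivity) (by linarith) hDn)
  have h2 : 4 * L / countN w s a h ≤ 4 * L / D :=
    div_le_div_of_nonneg_left (by positivity) (by linarith) hDn
  have h3 : 4 * L / D ≤ 14 * L / (3 * D) := by
    rw [div_le_div_iff₀ (by linarith) (by linarith)]
    nlinarith
  have h4 : 0 ≤ 4 * L / D := by positivity
  rw [abs_le]
  constructor <;> linarith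

end Deviation

/-! ### Union bound over triples, visit counts and next states. -/

section GoodEvent

open scoped ENNReal

variable {S A : Type*} [Fintype S] [Fintype A] [DecidableEq S] [DecidableEq A]
  [MeasurableSpace S] [DiscreteMeasurableSpace S] [MeasurableSpace A]
  [DiscreteMeasurableSpace A] {H : ℕ}

lemma measure_iUnion_union_le {Ω ι : Type*} [MeasurableSpace Ω] [Fintype ι] (μ : Measure Ω)
    (T T' : ι → Set Ω) {c : ℝ} (hc : 0 ≤ c) (hT : ∀ i, μ (T i) ≤ ENNReal.ofReal c)
    (hT' : ∀ i, μ (T' i) ≤ ENNReal.ofReal c) :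
    μ (⋃ i, T i ∪ T' i) ≤ ENNReal.ofReal (Fintype.card ι * (2 * c)) :=
  calc μ (⋃ i, T i ∪ T' i) ≤ ∑ i, μ (T i ∪ T' i) := measure_iUnion_fintype_le _ _
    _ ≤ ∑ _i : ι, ENNReal.ofReal (2 * c) := Finset.sum_le_sum fun i _ => by
        rw [two_mul, ENNReal.ofReal_add hc hc]
        exact (measure_union_le _ _).trans (add_le_add (hT i) (hT' i))
    _ = ENNReal.ofReal (Fintype.card ι * (2 * c)) := by
        rw [Finset.sum_const, Finset.card_univ, nsmul_eq_mul,
          ENNReal.ofReal_mul (p := (Fintype.card ι : ℝ)) (by positivity), ENNReal.ofReal_natCast]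

/-- Outside an event of probability at most `4 δ`, all cost estimates and all transition estimates
are within their confidence radii. -/
theorem exists_confidence_event (M : CMDP S A H) {νf νg : ℕ → S × A × Fin H → Measure ℝ}
    (hνf : ∀ k i, IsNoise (νf k i)) (hνg : ∀ k i, IsNoise (νg k i)) (L : Learner S A H)
    {K : ℕ} {δ : ℝ} (hδ0 : 0 < δ) (hδ1 : δ < 1) (hL : 1 ≤ logTerm S A H K δ) (hH : 1 ≤ H)
    (hS : 1 ≤ Fintype.card S) (hA : 1 ≤ Fintype.card A) (hK : 1 ≤ K) :
    ∃ B : Set (Hist S A H K), runLaw M νf νg L K B ≤ ENNReal.ofReal (4 * δ) ∧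
      ∀ ω ∉ B, ∀ k : Fin K,
        (∀ s a h, |empCost (Fin.take k k.isLt.le ω) s a h - M.cost s a h|
          ≤ radiusFn K δ (Fin.take k k.isLt.le ω) s a h) ∧
        M.trans ∈ confSet K δ (Fin.take k k.isLt.le ω) := by
  have := fun k i => (hνf k i).1
  have := fun k i => (hνg k i).1
  set l := logTerm S A H K δ with hl
  have hl0 : 0 ≤ l := by linarith
  set μ := runLaw M νf νg L K
  have hP := M.trans_isKernel
  have hPle : ∀ s a h s', M.trans s a h s' ≤ 1 := fun s a h s' => by
    rw [← (hP s a h).2]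
    exact Finset.single_le_sum (fun i _ => (hP s a h).1 i) (Finset.mem_univ s')
  choose tU htU using fun (s : S) (a : A) (h : Fin H) (s' : S) (i : ℕ) =>
    exists_tilt_upper i.succ_pos ((hP s a h).1 s') hl0
  choose tL htL using fun (s : S) (a : A) (h : Fin H) (s' : S) (i : ℕ) =>
    exists_tilt_lower i.succ_pos (hPle s a h s') hl0
  -- Index `i` stands for `i + 1` visits; the case of no visits is deterministic.
  set v : ℕ → ℝ := fun i => 2 * Real.sqrt (l / (i + 1 : ℕ)) with hv
  set BC : S × A × Fin H × Fin K → Set (Hist S A H K) := fun x =>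
    tailSet K x.1 x.2.1 x.2.2.1 (x.2.2.2 + 1)
      (costStat M x.1 x.2.1 x.2.2.1 (v x.2.2.2)) l ∪
    tailSet K x.1 x.2.1 x.2.2.1 (x.2.2.2 + 1)
      (costStat M x.1 x.2.1 x.2.2.1 (-v x.2.2.2)) l with hBC
  set BP : (S × A × Fin H × Fin K) × S → Set (Hist S A H K) := fun x =>
    tailSet K x.1.1 x.1.2.1 x.1.2.2.1 (x.1.2.2.2 + 1) (transStat M x.1.1 x.1.2.1 x.1.2.2.1 x.2
      (tU x.1.1 x.1.2.1 x.1.2.2.1 x.2 x.1.2.2.2)) (2 * l) ∪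
    tailSet K x.1.1 x.1.2.1 x.1.2.2.1 (x.1.2.2.2 + 1) (transStat M x.1.1 x.1.2.1 x.1.2.2.1 x.2
      (tL x.1.1 x.1.2.1 x.1.2.2.1 x.2 x.1.2.2.2)) (2 * l) with hBP
  have hcost : ∀ s a h n t, μ (tailSet K s a h n (costStat M s a h t) l)
      ≤ ENNReal.ofReal (Real.exp (-l)) := fun s a h n t =>
    runLaw_sum_visit_ge_le M νf νg L s a h n (measurable_costStat M s a h t)
      (fun k π hπ => lintegral_costStat_le_one M (hνf k) (hνg k) s a h t hπ) K l
  have htrans : ∀ s a h s' n t, μ (tailSet K s a h n (transStat M s a h s' t) (2 * l))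
      ≤ ENNReal.ofReal (Real.exp (-(2 * l))) := fun s a h s' n t =>
    runLaw_sum_visit_ge_le M νf νg L s a h n (measurable_transStat M s a h s' t)
      (fun k π hπ => lintegral_transStat_le_one M (νf k) (νg k) s a h s' t hπ) K (2 * l)
  have hexp : Real.exp (-l) = δ / ((H : ℝ) * Fintype.card S * Fintype.card A * K) :=
    exp_neg_logTerm hδ0 hH hS hA hK
  have hH' : (1 : ℝ) ≤ H := by exact_mod_cast hH
  have hS' : (1 : ℝ) ≤ Fintype.card S := by exact_mod_cast hS
  have hA' : (1 : ℝ) ≤ Fintype.card A := by exact_mod_cast hA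
  have hK' : (1 : ℝ) ≤ K := by exact_mod_cast hK
  have hBCμ : μ (⋃ x, BC x) ≤ ENNReal.ofReal (2 * δ) := by
    refine (measure_iUnion_union_le μ _ _ (Real.exp_nonneg (-l)) (fun x => hcost _ _ _ _ _)
      fun x => hcost _ _ _ _ _).trans (ENNReal.ofReal_le_ofReal (le_of_eq ?_))
    rw [hexp]
    simp only [Fintype.card_prod, Fintype.card_fin]
    push_cast
    field_simp
  have hBPμ : μ (⋃ x, BP x) ≤ ENNReal.ofReal (2 * δ) := by
    refine (measure_iUnion_union_le μ _ _ (Real.exp_nonneg (-(2 * l))) (fun x => htrans _ _ _ _ _ _)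
      fun x => htrans _ _ _ _ _ _).trans (ENNReal.ofReal_le_ofReal ?_)
    -- Level `2L` rather than `L` pays for the extra union over the `S` next states.
    rw [show -(2 * l) = -l + -l by ring, Real.exp_add, hexp]
    simp only [Fintype.card_prod, Fintype.card_fin]
    push_cast
    have h1 : (1 : ℝ) ≤ H * Fintype.card A * K :=
      one_le_mul_of_one_le_of_one_le (one_le_mul_of_one_le_of_one_le hH' hA') hK'
    have e : (Fintype.card S : ℝ) * (Fintype.card A * (H * K)) * Fintype.card S
        * (2 * (δ / ((H : ℝ) * Fintype.card S * Fintype.card A * K)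
          * (δ / ((H : ℝ) * Fintype.card S * Fintype.card A * K))))
        = 2 * δ * (δ / (H * Fintype.card A * K)) := by
      field_simp
    rw [e]
    refine mul_le_of_le_one_right (by positivity) ?_
    rw [div_le_one (by positivity)]
    linarith
  refine ⟨(⋃ x, BC x) ∪ ⋃ x, BP x, ?_, fun ω hω k => ?_⟩
  · refine (measure_union_le _ _).trans ((add_le_add hBCμ hBPμ).trans (le_of_eq ?_))
    rw [← ENNReal.ofReal_add (by positivity) (by positivity)]
    ring_nf
  rw [Set.mem_union, not_or, Set.mem_iUnion, Set.mem_iUnion, not_exists, not_exists] at hω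
  obtain ⟨hωC, hωP⟩ := hω
  set w : Hist S A H k := Fin.take k k.isLt.le ω with hw
  refine ⟨fun s a h => ?_, hP, fun s a h s' => ?_⟩
  · rcases Nat.eq_zero_or_pos (countN w s a h) with h0 | hpos
    · exact abs_empCost_sub_le_of_countN_eq_zero M.cost_mem hL w h0
    have hlt : countN w s a h - 1 < K := by
      have : countN w s a h < K := countN_take_lt ω k s a h
      omega
    have hn : countN w s a h - 1 + 1 = countN w s a h := by omega
    have hnot := hωC (s, a, h, ⟨countN w s a h - 1, hlt⟩)
    simp only [hBC, hv, hn, Set.mem_union, not_or] at hnot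
    refine abs_empCost_sub_le hL w hpos fun t ht => ?_
    rw [← sum_visit_mul_costStat]
    by_contra! hge
    rcases (abs_eq (by positivity)).1 ht with rfl | rfl
    · exact hnot.1 ⟨k, k.isLt.le, rfl, hge⟩
    · exact hnot.2 ⟨k, k.isLt.le, rfl, hge⟩
  · rcases Nat.eq_zero_or_pos (countN w s a h) with h0 | hpos
    · exact abs_sub_empKer_le_of_countN_eq_zero hP hL w h0 s'
    have hlt : countN w s a h - 1 < K := by
      have : countN w s a h < K := countN_take_lt ω k s a h
      omega
    have hn : countN w s a h - 1 + 1 = countN w s a h := by omega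
    have hnot := hωP ((s, a, h, ⟨countN w s a h - 1, hlt⟩), s')
    simp only [hBP, hn, Set.mem_union, not_or] at hnot
    have hU := htU s a h s' (countN w s a h - 1) (countM w s a s' h)
    have hLo := htL s a h s' (countN w s a h - 1) (countM w s a s' h)
    rw [Nat.succ_eq_add_one, hn, ← sum_visit_mul_transStat] at hU hLo
    refine abs_sub_empKer_le hL w hpos ?_ ?_
    · by_contra! hlt
      exact hnot.1 ⟨k, k.isLt.le, rfl, hU hlt⟩
    · by_contra! hlt
      exact hnot.2 ⟨k, k.isLt.le, rfl, hLo hlt⟩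

end GoodEvent

end DOPEPlus

/-! ### The theorem. -/

open DOPEPlus

theorem mainTheorem3 {S A : Type*} [Fintype S] [Fintype A] [DecidableEq S] [DecidableEq A]
    [MeasurableSpace S] [DiscreteMeasurableSpace S] [MeasurableSpace A]
    [DiscreteMeasurableSpace A] {H : ℕ} (M : DOPEPlus.CMDP S A H)
    (hC : M.budget ∈ Set.Ioo (0 : ℝ) (H : ℝ))
    (πb : DOPEPlus.Pol S A H) (hπb : DOPEPlus.IsPolicy πb)
    (hsafe : DOPEPlus.value M.init πb M.cost M.trans < M.budget)
    (νf νg : ℕ → S × A × Fin H → Measure ℝ)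
    (hνf : ∀ k i, DOPEPlus.IsNoise (νf k i)) (hνg : ∀ k i, DOPEPlus.IsNoise (νg k i))
    (K K₀ : ℕ) (δ : ℝ) (hδ : δ ∈ Set.Ioo (0 : ℝ) 1)
    (L : DOPEPlus.Learner S A H) (hL : DOPEPlus.IsDOPEPlus M πb K K₀ δ L) :
    ∃ E : Set (DOPEPlus.Hist S A H K), MeasurableSet E ∧
      ENNReal.ofReal (1 - 14 * δ) ≤ DOPEPlus.runLaw M νf νg L K E ∧
      ∀ ω ∈ E,
        -- every policy computed by DOPE+ satisfies the true constraint
        (∀ k : Fin K, DOPEPlus.Computed M K K₀ δ (Fin.take k k.isLt.le ω) →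
          DOPEPlus.value M.init (DOPEPlus.playedPolicy L ω k) M.cost M.trans ≤ M.budget) ∧
        -- if all `K` policies are computed, the hard constraint violation is zero
        ((∀ k : Fin K, DOPEPlus.Computed M K K₀ δ (Fin.take k k.isLt.le ω)) →
          DOPEPlus.violation M (DOPEPlus.playedPolicy L ω) = 0) ∧
        -- DOPE+ does compute the policy of every episode at which `K₀` is large enough in that
        -- the pessimism accumulated along the baseline policy is at most its slack
        (∀ k : Fin K,
          (K₀ ≤ k → DOPEPlus.value M.init πb (fun s a h =>
            2 * DOPEPlus.radiusFn K δ (Fin.take k k.isLt.le ω) s a h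
              + DOPEPlus.bonusU K δ (Fin.take k k.isLt.le ω) s a h) M.trans
            ≤ M.budget - DOPEPlus.value M.init πb M.cost M.trans) →
          DOPEPlus.Computed M K K₀ δ (Fin.take k k.isLt.le ω)) := by
  have := fun k i => (hνf k i).1
  have := fun k i => (hνg k i).1
  -- For `14 δ ≥ 1` the empty event will do; otherwise `δ < 1/14 < 1/e`, which yields `L ≥ 1`.
  rcases le_or_gt 1 (14 * δ) with hδl | hδs
  · exact ⟨∅, MeasurableSet.empty, by simp [hδl], fun ω hω => hω.elim⟩
  have hH : 1 ≤ H := by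
    have : (0 : ℝ) < H := hC.1.trans hC.2
    exact_mod_cast this
  have hS : 1 ≤ Fintype.card S := by
    rw [Nat.one_le_iff_ne_zero, Ne, Fintype.card_eq_zero_iff]
    intro hempty
    simpa using M.init_sum
  have hA : 1 ≤ Fintype.card A := by
    rw [Nat.one_le_iff_ne_zero, Ne, Fintype.card_eq_zero_iff]
    intro hempty
    obtain ⟨s⟩ := Fintype.card_pos_iff.1 hS
    simpa using (hπb s ⟨0, hH⟩).2
  rcases Nat.eq_zero_or_pos K with rfl | hK
  · refine ⟨Set.univ, MeasurableSet.univ, ?_, fun ω _ =>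
      ⟨fun k => k.elim0, fun _ => by simp [violation], fun k => k.elim0⟩⟩
    rw [runLaw_univ]
    exact ENNReal.ofReal_le_one.2 (by linarith [hδ.1])
  have hlog : 1 ≤ logTerm S A H K δ := one_le_logTerm hδ.1 hδs hH hS hA hK
  obtain ⟨B, hB, hgood⟩ := exists_confidence_event M hνf hνg L hδ.1 hδ.2 hlog hH hS hA hK
  -- Passing to a measurable hull of the bad event costs no probability and avoids proving it
  -- measurable.
  refine ⟨(toMeasurable (runLaw M νf νg L K) B)ᶜ, (measurableSet_toMeasurable _ _).compl, ?_,
    fun ω hω => ?_⟩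
  · rw [prob_compl_eq_one_sub (measurableSet_toMeasurable _ _), measure_toMeasurable]
    refine le_trans (b := 1 - ENNReal.ofReal (4 * δ)) ?_ (tsub_le_tsub_left hB _)
    rw [← ENNReal.ofReal_one, ← ENNReal.ofReal_sub _ (by linarith [hδ.1])]
    exact ENNReal.ofReal_le_ofReal (by linarith [hδ.1])
  have hgω := hgood ω fun h => hω (subset_toMeasurable _ _ h)
  have hcost : ∀ k : Fin K, Computed M K K₀ δ (Fin.take k k.isLt.le ω) →
      value M.init (playedPolicy L ω k) M.cost M.trans ≤ M.budget := by
    intro k hk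
    obtain ⟨hrad, hconf⟩ := hgω k
    obtain ⟨hbase, hsol⟩ := hL k k.isLt (Fin.take k k.isLt.le ω)
    rcases lt_or_ge (k : ℕ) K₀ with hlt | hge
    · rw [playedPolicy, hbase hlt]
      exact hsafe.le
    · obtain ⟨⟨hpol, hker, hval⟩, -⟩ := hsol hge (hk.resolve_left (by omega))
      refine le_trans (value_le_value_add_bonusU M.init_nonneg M.init_sum hpol M.cost_mem hlog
        hH hS hA hK hconf hker) (le_trans ?_ hval)
      refine value_mono M.init_nonneg hpol hker.1 fun s a h => ?_
      have := (abs_le.1 (hrad s a h)).1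
      simp only [pessCost]
      linarith
  refine ⟨hcost, fun hall => ?_, fun k hk => ?_⟩
  · exact Finset.sum_eq_zero fun k _ => max_eq_left (sub_nonpos.2 (hcost k (hall k)))
  · rcases lt_or_ge (k : ℕ) K₀ with hlt | hge
    · exact Or.inl hlt
    obtain ⟨hrad, hconf⟩ := hgω k
    -- The baseline policy with the true kernel is the feasible point.
    refine Or.inr ⟨(πb, M.trans), hπb, hconf, ?_⟩
    have h1 : value M.init πb (pessCost K δ (Fin.take k k.isLt.le ω)) M.trans
        ≤ value M.init πb (fun s a h => M.cost s a h
          + (2 * radiusFn K δ (Fin.take k k.isLt.le ω) s a h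
            + bonusU K δ (Fin.take k k.isLt.le ω) s a h)) M.trans := by
      refine value_mono M.init_nonneg hπb M.trans_isKernel fun s a h => ?_
      have := (abs_le.1 (hrad s a h)).2
      simp only [pessCost]
      linarith
    rw [value_add] at h1
    exact h1.trans (by linarith [hk hge])
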